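/- Let $n\in\mathbb N$, $h\ge 0$, $\gamma_m>0$ and $A,A_1\in\mathbb R^{n\times n}$, and consider the linear time-delay system $$\dot e(t)=Ae(t)+A_1e(t-h)+w(t),\qquad t\ge 0,\qquad e|_{[-h,0]}=e_0\in C([-h,0],\mathbb R^n),$$ with measurable, essentially bounded inputs $w:[0,\infty)\to\mathbb R^n$. Solutions are continuous functions that are absolutely continuous for $t\ge0$ and satisfy the equation for almost every $t$. Suppose there are symmetric positive definite matrices $P,R,S\in\mathbb R^{n\times n}$ and arbitrary matrices $P_2,P_3,P_4\in\mathbb R^{n\times n}$ such that the symmetric matrix $$W=\begin{bmatrix} A^\top P_2+P_2^\top A+S-R+\gamma_m^2I_n & P-P_2^\top+A^\top P_3 & P_2^\top A_1+R & P_2^\top+A^\top P_4\\ * & -P_3-P_3^\top+h^2R & P_3^\top A_1 & P_3^\top-P_4\\ * & * & -S-R & A_1^\top P_4\\ * & * & * & P_4^\top+P_4-I_n \end{bmatrix}$$ is negative definite (asterisks denote the blocks that make $W$ symmetric). Then the system is input-to-state stable (ISS) with the linear gain margin $\rho(\theta)=\gamma_m\theta$. That is, the system is ISS, and for every feedback law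 $\kappa:\mathbb R^n\times\mathbb R\to\mathbb R^n$ with $\|\kappa(\xi,t)\|\le\gamma_m\|\xi\|$ for all $\xi,t$, the perturbed system $$\dot e(t)=Ae(t)+A_1e(t-h)+\kappa(e(t),t)+w(t)$$ is again ISS with input $w$. Here a system is ISS if there are $\beta\in\mathcal{KL}$ and $\mu\in\mathcal K$ such that for all $e_0$ and $w$ every solution, on whatever interval $[-h,T]$ it is defined, satisfies $$\|e(t)\|\le\beta\Big(\max_{[-h,0]}\|e_0\|,\,t\Big)+\mu\big(\|w\|_\infty\big),\qquad 0\le t\le T,$$ and, moreover, a solution on $[-h,\infty)$ exists for all $e_0$ and $w$ and every solution on $[-h,T]$ extends to one on $[-h,\infty)$. The existence and extension of solutions is asserted for feedback laws $\kappa(\xi,t)$ that are continuous in $\xi$ and Lebesgue measurable in $t$; the estimate holds for all $\kappa$ satisfying the bound. -/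

import Mathlib

open MeasureTheory Filter Topology
open scoped NNReal ENNReal

namespace DelayISS

/-- Comparison functions of class `K`, on the nonnegative reals. -/
structure ClassK (α : ℝ≥0 → ℝ≥0) : Prop where
  continuous : Continuous α
  strictMono : StrictMono α
  map_zero : α 0 = 0

/-- Comparison functions of class `K_∞`. -/
structure ClassKInf (α : ℝ≥0 → ℝ≥0) : Prop where
  classK : ClassK α
  tendsto : Tendsto α atTop atTop

/-- Comparison functions of class `KL`. -/
structure ClassKL (β : ℝ≥0 → ℝ≥0 → ℝ≥0) : Prop where
  classK : ∀ t, ClassK (fun θ => β θ t)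
  continuous : ∀ θ, Continuous (β θ)
  antitone : ∀ θ, Antitone (β θ)
  tendsto : ∀ θ, Tendsto (β θ) atTop (𝓝 0)

/-- The space `C([-h,0], E)`; its norm is the uniform norm. -/
abbrev Hist (h : ℝ≥0) (E : Type*) [TopologicalSpace E] : Type _ :=
  C(Set.Icc (-(h : ℝ)) 0, E)

section Systems

variable {E G : Type*} [NormedAddCommGroup E] [NormedSpace ℝ E]
  [NormedAddCommGroup G] {h : ℝ≥0}

/-- The value `φ(0)`. -/
def Hist.now (φ : Hist h E) : E := φ ⟨0, by simp⟩

/-- The value `φ(-h)`. -/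
def Hist.delayed (φ : Hist h E) : E := φ ⟨-(h : ℝ), by simp⟩

/-- The segment `x_t`, given by `x_t(θ) = x(t + θ)` for `-h ≤ θ ≤ 0`. -/
def segment (h : ℝ≥0) (x : C(ℝ, E)) (t : ℝ) : Hist h E where
  toFun θ := x (t + θ)
  continuous_toFun := by fun_prop

/-- `e` is a (Carathéodory) solution on `[-h, T]` of `e'(t) = F(t, e_t, w(t))` with initial
function `e₀`: it is absolutely continuous on `[0, T]` and satisfies the equation almost everywhere
there, which is written in integral form. The values of `e` outside `[-h, T]` are
irrelevant; a continuous function on `[-h, T]` always extends continuously to `ℝ`. -/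
structure IsSolutionOn (F : ℝ → Hist h E → G → E) (e₀ : Hist h E) (w : ℝ → G) (T : ℝ)
    (e : C(ℝ, E)) : Prop where
  initial : segment h e 0 = e₀
  integrable : IntervalIntegrable (fun s => F s (segment h e s) (w s)) volume 0 T
  eq_integral : ∀ t ∈ Set.Icc 0 T, e t = e 0 + ∫ s in (0 : ℝ)..t, F s (segment h e s) (w s)

/-- Inputs on `[0, ∞)` : Lebesgue measurable and essentially bounded. -/
def IsInput (w : ℝ → G) : Prop := MemLp w ∞ (volume.restrict (Set.Ici 0))

/-- The essential supremum norm of an input on `[0, ∞)`. -/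
noncomputable def inputNorm (w : ℝ → G) : ℝ≥0 :=
  (eLpNorm w ∞ (volume.restrict (Set.Ici 0))).toNNReal

/-- The input-to-state estimate, for every solution on every interval `[-h, T]`. -/
def ISSEstimate (F : ℝ → Hist h E → G → E) : Prop :=
  ∃ (β : ℝ≥0 → ℝ≥0 → ℝ≥0) (μ : ℝ≥0 → ℝ≥0), ClassKL β ∧ ClassK μ ∧
    ∀ (e₀ : Hist h E) (w : ℝ → G), IsInput w →
      ∀ (T : ℝ≥0) (e : C(ℝ, E)), IsSolutionOn F e₀ w T e →
        ∀ t : ℝ≥0, t ≤ T → ‖e t‖₊ ≤ β ‖e₀‖₊ t + μ (inputNorm w)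

/-- Every solution on an interval `[-h, T]`, `T ≥ 0`, extends to a solution on `[-h, ∞)`.
For `T = 0` this says that a solution on `[-h, ∞)` exists for each initial function and input. -/
def ForwardComplete (F : ℝ → Hist h E → G → E) : Prop :=
  ∀ (e₀ : Hist h E) (w : ℝ → G), IsInput w →
    ∀ (T : ℝ≥0) (e : C(ℝ, E)), IsSolutionOn F e₀ w T e →
      ∃ e' : C(ℝ, E), (∀ T' : ℝ≥0, IsSolutionOn F e₀ w T' e') ∧
        ∀ t ∈ Set.Icc (-(h : ℝ)) T, e' t = e t

/-- Input-to-state stability of `e'(t) = F(t, e_t, w(t))`: solutions exist for all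
`t ≥ 0` and satisfy the input-to-state estimate. -/
def IsISS (F : ℝ → Hist h E → G → E) : Prop := ForwardComplete F ∧ ISSEstimate F

/-- The right-hand side of `e'(t) = f(e_t, κ(e_t(0), t) + w(t))`. -/
def closedLoop (f : Hist h E → G → E) (κ : E → ℝ → G) : ℝ → Hist h E → G → E :=
  fun t φ v => f φ (κ φ.now t + v)

/-- Carathéodory feedback laws: continuous in the state, Lebesgue measurable in time. -/
structure Caratheodory (κ : E → ℝ → G) : Prop where
  continuous : ∀ t, Continuous fun ξ => κ ξ t
  measurable : ∀ ξ, AEStronglyMeasurable (κ ξ) volume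

/-- The system `e'(t) = f(e_t, w(t))` is ISS with gain margin `ρ`. For a feedback law `κ` that
respects `ρ`, all solutions of the perturbed system satisfy an ISS estimate, with no regularity of
`κ` at all; if moreover `κ` is a Carathéodory function, so that solutions may be expected to
exist, then the perturbed system is ISS (in particular, its solutions do exist for all times). -/
structure HasGainMargin (f : Hist h E → G → E) (ρ : ℝ≥0 → ℝ≥0) : Prop where
  classKInf : ClassKInf ρ
  iss : IsISS (fun _ : ℝ => f)
  estimate : ∀ κ : E → ℝ → G, (∀ ξ t, ‖κ ξ t‖₊ ≤ ρ ‖ξ‖₊) → ISSEstimate (closedLoop f κ)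
  robust : ∀ κ : E → ℝ → G, Caratheodory κ → (∀ ξ t, ‖κ ξ t‖₊ ≤ ρ ‖ξ‖₊) →
    IsISS (closedLoop f κ)

end Systems

section Linear

variable {n : ℕ}

/-- The right-hand side `f(φ, w) = A φ(0) + A₁ φ(-h) + w`. -/
noncomputable def linearDelay (h : ℝ≥0) (A A₁ : Matrix (Fin n) (Fin n) ℝ)
    (φ : Hist h (EuclideanSpace ℝ (Fin n))) (w : EuclideanSpace ℝ (Fin n)) :
    EuclideanSpace ℝ (Fin n) :=
  A.toEuclideanLin φ.now + A₁.toEuclideanLin φ.delayed + w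

open scoped Matrix in
/-- The symmetric `4n × 4n` block matrix `W`; `Matrix.comp` flattens a matrix of blocks. -/
def lmiMatrix (h γ : ℝ) (A A₁ P R S P₂ P₃ P₄ : Matrix (Fin n) (Fin n) ℝ) :
    Matrix (Fin 4 × Fin n) (Fin 4 × Fin n) ℝ :=
  Matrix.comp (Fin 4) (Fin 4) (Fin n) (Fin n) ℝ
    !![Aᵀ * P₂ + P₂ᵀ * A + S - R + γ ^ 2 • (1 : Matrix (Fin n) (Fin n) ℝ),
        P - P₂ᵀ + Aᵀ * P₃, P₂ᵀ * A₁ + R, P₂ᵀ + Aᵀ * P₄;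
      (P - P₂ᵀ + Aᵀ * P₃)ᵀ, -P₃ - P₃ᵀ + h ^ 2 • R, P₃ᵀ * A₁, P₃ᵀ - P₄;
      (P₂ᵀ * A₁ + R)ᵀ, (P₃ᵀ * A₁)ᵀ, -S - R, A₁ᵀ * P₄;
      (P₂ᵀ + Aᵀ * P₄)ᵀ, (P₃ᵀ - P₄)ᵀ, (A₁ᵀ * P₄)ᵀ, P₄ᵀ + P₄ - 1]

end Linear

end DelayISS

/-! The estimate is Lyapunov–Krasovskii analysis by the descriptor method. With x = e(t), y = e'(t),
z = e(t-h) and v = κ + w, the dynamics read Ax + A₁z + v - y = 0. Adding twice the inner product of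
this zero vector with P₂x + P₃y + P₄v to 2⟨y,Px⟩ + ⟨x,Sx⟩ - ⟨z,Sz⟩ + h²⟨y,Ry⟩ - ⟨x-z,R(x-z)⟩ +
γ²‖x‖² - ‖v‖² produces exactly the quadratic form of W in (x,y,z,v). Negative definiteness therefore
gives dissipation with a margin ε > 0 (`exists_isDissipative`). Since ‖v‖ ≤ γ‖x‖ + ‖w‖, the term
γ²‖x‖² pays for the feedback, and ε pays for the cross term with the input and for a small
exponential weight (`IsDissipative.weighted_le`).

No functional is differentiated. The pointwise inequality is multiplied by exp(kt) and integrated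
from h to τ; Jensen's inequality bounds the R-term by an integral of ⟨e',Re'⟩ over the delay
interval, and the delayed integrals are absorbed by the undelayed ones up to contributions of [0,h]
(`IsPerturbedTrajectory.exp_mul_inner_le`). Integration starts at h because e' is controlled only
for t ≥ 0; on [0,h] Gronwall's inequality suffices. The constants depend on the matrices, h and γ
alone, and the feedback enters only through its norm bound, so no regularity of κ is needed.

Existence for Carathéodory feedback has no Lipschitz condition to rely on. It follows from Tonelli's
delayed approximations and Arzelà–Ascoli on a set of curves dominated by an a priori exponential
bound (`LinearGrowth.exists_fixed_point`). Linear growth makes that bound global in time, so one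
limit gives the solution for all t ≥ T. -/

namespace DelayISS

/-! ### Existence and continuation for functional differential equations of linear growth -/

section Existence

variable {E : Type*} [NormedAddCommGroup E] {h : ℝ≥0}

/-- Joint continuity is needed because in Tonelli's scheme the curve and the time shift converge
simultaneously. -/
theorem continuous_segment_uncurry :
    Continuous fun p : C(ℝ, E) × ℝ => segment h p.1 p.2 := by
  refine ContinuousMap.continuous_of_continuous_uncurry _ ?_
  change Continuous fun q : (C(ℝ, E) × ℝ) × Set.Icc (-(h : ℝ)) 0 => q.1.1 (q.1.2 + q.2)
  fun_prop

theorem norm_segment_le {x : C(ℝ, E)} {t r : ℝ} (hr : 0 ≤ r) (hx : ∀ s ≤ t, ‖x s‖ ≤ r) :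
    ‖segment h x t‖ ≤ r :=
  (ContinuousMap.norm_le _ hr).2 fun θ => hx _ (by linarith [θ.2.2])

theorem segment_congr {x y : C(ℝ, E)} {t : ℝ} (hxy : ∀ s ∈ Set.Icc (t - h) t, x s = y s) :
    segment h x t = segment h y t := by
  ext θ
  exact hxy _ ⟨by linarith [θ.2.1], by linarith [θ.2.2]⟩

/-- The continuous functions that vanish at `T` and whose modulus of continuity is dominated
by the increments of `b`. -/
def dominatedFunctions (E : Type*) [NormedAddCommGroup E] (b : ℝ → ℝ) (T : ℝ) : Set C(ℝ, E) :=
  {y | y T = 0 ∧ ∀ s t, ‖y t - y s‖ ≤ |b t - b s|}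

theorem continuous_of_norm_sub_le_abs_sub {b : ℝ → ℝ} (hb : Continuous b) {f : ℝ → E}
    (hf : ∀ s t, ‖f t - f s‖ ≤ |b t - b s|) : Continuous f := by
  refine continuous_iff_continuousAt.2 fun s => ?_
  refine tendsto_iff_norm_sub_tendsto_zero.2 ?_
  refine squeeze_zero (fun _ => norm_nonneg _) (fun t => hf s t) ?_
  have : Tendsto (fun t => |b t - b s|) (𝓝 s) (𝓝 |b s - b s|) :=
    ((hb.sub continuous_const).abs).tendsto s
  simpa using this

/-- Arzelà–Ascoli: the increments of `b` are a common modulus of continuity, the values at `t` lie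
in the compact ball of radius |b t - b T|, and the defining conditions are closed under pointwise
limits. -/
theorem isCompact_dominatedFunctions [ProperSpace E] {b : ℝ → ℝ} (hb : Continuous b) (T : ℝ) :
    IsCompact (dominatedFunctions E b T) := by
  refine ArzelaAscoli.isCompact_of_equicontinuous _ ?_ ?_
  · have himage : ContinuousMap.toFun '' dominatedFunctions E b T =
        {f : ℝ → E | f T = 0 ∧ ∀ s t, ‖f t - f s‖ ≤ |b t - b s|} := by
      ext f
      constructor
      · rintro ⟨y, hy, rfl⟩
        exact hy
      · intro hf
        exact ⟨⟨f, continuous_of_norm_sub_le_abs_sub hb hf.2⟩, hf, rfl⟩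
    rw [himage]
    refine IsCompact.of_isClosed_subset
      (isCompact_univ_pi fun t => isCompact_closedBall (0 : E) |b t - b T|) ?_ ?_
    · have hinter : {f : ℝ → E | f T = 0 ∧ ∀ s t, ‖f t - f s‖ ≤ |b t - b s|} =
          {f | f T = 0} ∩ ⋂ s, ⋂ t, {f | ‖f t - f s‖ ≤ |b t - b s|} := by
        ext f
        simp
      rw [hinter]
      refine IsClosed.inter (isClosed_eq (continuous_apply T) continuous_const) ?_
      exact isClosed_iInter fun s => isClosed_iInter fun t => isClosed_le
        ((continuous_apply t).sub (continuous_apply s)).norm continuous_const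
    · intro f hf t _
      have := hf.2 T t
      rw [hf.1, sub_zero] at this
      simpa using this
  · intro s
    refine Metric.equicontinuousAt_of_continuity_modulus (fun t => |b t - b s|) ?_ _ ?_
    · have : Tendsto (fun t => |b t - b s|) (𝓝 s) (𝓝 |b s - b s|) :=
        ((hb.sub continuous_const).abs).tendsto s
      simpa using this
    · refine Eventually.of_forall fun t y => ?_
      rw [dist_comm, dist_eq_norm]
      exact y.2.2 s t

/-- The a priori bound for solutions of a functional differential equation whose right-hand side
grows linearly with rate `K`: constant `M` up to time `T`, exponentially growing afterwards. -/
noncomputable def growthBound (M K T t : ℝ) : ℝ := M * Real.exp (K * (max T t - T))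

theorem growthBound_of_le {M K T t : ℝ} (ht : t ≤ T) : growthBound M K T t = M := by
  simp [growthBound, ht]

theorem continuous_growthBound (M K T : ℝ) : Continuous (growthBound M K T) := by
  unfold growthBound
  fun_prop

theorem monotone_growthBound {M K : ℝ} (hM : 0 ≤ M) (hK : 0 ≤ K) (T : ℝ) :
    Monotone (growthBound M K T) := by
  intro s t hst
  unfold growthBound
  gcongr

theorem le_growthBound {M K : ℝ} (hM : 0 ≤ M) (hK : 0 ≤ K) (T t : ℝ) :
    M ≤ growthBound M K T t := by
  have h1 : 0 ≤ K * (max T t - T) := mul_nonneg hK (sub_nonneg.2 (le_max_left _ _))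
  have := mul_le_mul_of_nonneg_left (Real.one_le_exp h1) hM
  simpa [growthBound] using this

theorem integral_growthBound {M K T s t : ℝ} (hs : T ≤ s) (hst : s ≤ t) :
    ∫ r in s..t, K * growthBound M K T r = growthBound M K T t - growthBound M K T s := by
  have hd : ∀ r ∈ Set.uIcc s t, HasDerivAt (fun r => M * Real.exp (K * (r - T)))
      (K * (M * Real.exp (K * (r - T)))) r := by
    intro r _
    have h1 : HasDerivAt (fun r => K * (r - T)) K r := by
      simpa using ((hasDerivAt_id r).sub_const T).const_mul K
    exact (h1.exp.const_mul M).congr_deriv (by ring)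
  have h2 : ∫ r in s..t, K * growthBound M K T r =
      ∫ r in s..t, K * (M * Real.exp (K * (r - T))) := by
    refine intervalIntegral.integral_congr fun r hr => ?_
    rw [Set.uIcc_of_le hst] at hr
    simp [growthBound, max_eq_right (hs.trans hr.1)]
  rw [h2, intervalIntegral.integral_eq_sub_of_hasDerivAt hd
    (Continuous.intervalIntegrable (by fun_prop) _ _)]
  simp [growthBound, max_eq_right hs, max_eq_right (hs.trans hst)]

/-- Hypotheses on a right-hand side of Carathéodory type with linear growth. -/
structure LinearGrowth (F : ℝ → Hist h E → E) (a c : ℝ) : Prop where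
  nonneg : 0 ≤ a
  continuous : ∀ s, Continuous (F s)
  measurable : ∀ x : C(ℝ, E),
    AEStronglyMeasurable (fun s => F s (segment h x s)) (volume.restrict (Set.Ici 0))
  bound : ∀ᵐ s ∂(volume.restrict (Set.Ici 0)), ∀ φ, ‖F s φ‖ ≤ a * ‖φ‖ + c

variable {F : ℝ → Hist h E → E} {a c M T : ℝ} {z : C(ℝ, E)}

/-- A segment taken `δ` earlier is a segment of the translated curve, so measurability along curves
applies. -/
theorem LinearGrowth.aestronglyMeasurable_shift (hF : LinearGrowth F a c) (x : C(ℝ, E)) (δ : ℝ) :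
    AEStronglyMeasurable (fun s => F s (segment h x (s - δ))) (volume.restrict (Set.Ici 0)) := by
  refine (hF.measurable (x.comp ⟨fun s => s - δ, by fun_prop⟩)).congr (ae_of_all _ fun s => ?_)
  refine congrArg (F s) ?_
  ext θ
  change x (s + θ - δ) = x (s - δ + θ)
  congr 1
  ring

/-- Write b for the growth bound. Domination gives ‖y‖ ≤ b - M, hence ‖z + y‖ ≤ b. The rate is `a +
1` because c ≤ M ≤ b lets the constant term be absorbed: a b + c ≤ (a + 1) b. -/
theorem LinearGrowth.norm_le_growthBound (hF : LinearGrowth F a c) (hM : 0 ≤ M) (hcM : c ≤ M)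
    (hz : ∀ t, ‖z t‖ ≤ M) : ∀ᵐ s ∂(volume.restrict (Set.Ici 0)),
      ∀ y ∈ dominatedFunctions E (growthBound M (a + 1) T) T, ∀ δ, 0 ≤ δ →
        ‖F s (segment h (z + y) (s - δ))‖ ≤ (a + 1) * growthBound M (a + 1) T s := by
  have ha := hF.nonneg
  filter_upwards [hF.bound] with s hs y hy δ hδ
  have hmono := monotone_growthBound hM (by linarith : 0 ≤ a + 1) T
  have hle := le_growthBound hM (by linarith : 0 ≤ a + 1) T
  have h1 : ‖segment h (z + y) (s - δ)‖ ≤ growthBound M (a + 1) T s := by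
    refine norm_segment_le (hM.trans (hle s)) fun τ hτ => ?_
    have h2 := hy.2 T τ
    rw [hy.1, sub_zero, growthBound_of_le le_rfl, abs_of_nonneg (sub_nonneg.2 (hle τ))] at h2
    calc ‖(z + y) τ‖ ≤ ‖z τ‖ + ‖y τ‖ := norm_add_le _ _
      _ ≤ growthBound M (a + 1) T τ := by linarith [hz τ]
      _ ≤ growthBound M (a + 1) T s := hmono (by linarith)
  have h3 := hs (segment h (z + y) (s - δ))
  have h4 := mul_le_mul_of_nonneg_left h1 ha
  linarith [hle s]

theorem LinearGrowth.intervalIntegrable (hF : LinearGrowth F a c) (hM : 0 ≤ M) (hcM : c ≤ M)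
    (hz : ∀ t, ‖z t‖ ≤ M) (hT : 0 ≤ T) {y : C(ℝ, E)}
    (hy : y ∈ dominatedFunctions E (growthBound M (a + 1) T) T) {δ : ℝ} (hδ : 0 ≤ δ)
    {s t : ℝ} (hs : T ≤ s) (ht : T ≤ t) :
    IntervalIntegrable (fun r => F r (segment h (z + y) (r - δ))) volume s t := by
  have hsub : Set.uIoc s t ⊆ Set.Ici 0 := fun r hr =>
    hT.trans ((le_min hs ht).trans hr.1.le)
  have hg : IntervalIntegrable (fun r => (a + 1) * growthBound M (a + 1) T r) volume s t :=
    ((continuous_growthBound M (a + 1) T).const_mul _).intervalIntegrable _ _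
  refine hg.mono_fun ((hF.aestronglyMeasurable_shift _ _).mono_measure
    (Measure.restrict_mono hsub le_rfl)) ?_
  filter_upwards [ae_restrict_of_ae_restrict_of_subset hsub
    (hF.norm_le_growthBound (T := T) hM hcM hz)] with r hr
  exact (hr y hy δ hδ).trans (Real.le_norm_self _)

variable [NormedSpace ℝ E]

/-- The dominated set is invariant under the integral operator: past `T` the growth bound solves b'
= (a + 1) b, so the bound on the integrand integrates to the increments of b. -/
theorem LinearGrowth.exists_integral_operator (hF : LinearGrowth F a c) (hM : 0 ≤ M)
    (hcM : c ≤ M) (hz : ∀ t, ‖z t‖ ≤ M) (hT : 0 ≤ T) {y : C(ℝ, E)}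
    (hy : y ∈ dominatedFunctions E (growthBound M (a + 1) T) T) {δ : ℝ} (hδ : 0 ≤ δ) :
    ∃ y' ∈ dominatedFunctions E (growthBound M (a + 1) T) T,
      ∀ t, y' t = ∫ r in T..max T t, F r (segment h (z + y) (r - δ)) := by
  set f : ℝ → E := fun r => F r (segment h (z + y) (r - δ)) with hf
  have hint : ∀ {s t}, T ≤ s → T ≤ t → IntervalIntegrable f volume s t := fun hs ht =>
    hF.intervalIntegrable hM hcM hz hT hy hδ hs ht
  have key : ∀ s t, s ≤ t → ‖(∫ r in T..max T t, f r) - ∫ r in T..max T s, f r‖ ≤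
      growthBound M (a + 1) T t - growthBound M (a + 1) T s := by
    intro s t hst
    rw [intervalIntegral.integral_interval_sub_left (hint le_rfl (le_max_left _ _))
      (hint le_rfl (le_max_left _ _))]
    have hle : max T s ≤ max T t := max_le_max le_rfl hst
    have e1 : ∀ u, growthBound M (a + 1) T (max T u) = growthBound M (a + 1) T u := by
      intro u; simp [growthBound]
    rw [← e1 t, ← e1 s, ← integral_growthBound (le_max_left T s) hle]
    refine intervalIntegral.norm_integral_le_of_norm_le hle ?_
      (((continuous_growthBound M (a + 1) T).const_mul _).intervalIntegrable _ _)
    have := (ae_restrict_iff' measurableSet_Ici).1 (hF.norm_le_growthBound (T := T) hM hcM hz)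
    filter_upwards [this] with r hr hr'
    exact hr (hT.trans ((le_max_left T s).trans hr'.1.le)) y hy δ hδ
  have key' : ∀ s t, ‖(∫ r in T..max T t, f r) - ∫ r in T..max T s, f r‖ ≤
      |growthBound M (a + 1) T t - growthBound M (a + 1) T s| := by
    intro s t
    rcases le_total s t with hst | hst
    · exact (key s t hst).trans (le_abs_self _)
    · rw [norm_sub_rev, abs_sub_comm]
      exact (key t s hst).trans (le_abs_self _)
  exact ⟨⟨_, continuous_of_norm_sub_le_abs_sub (continuous_growthBound M (a + 1) T) key'⟩,
    ⟨by simp, key'⟩, fun t => rfl⟩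

/-- Tonelli's approximate solutions: the state is replaced by its value a time `δ` earlier. -/
theorem LinearGrowth.exists_tonelli (hF : LinearGrowth F a c) (hM : 0 ≤ M)
    (hcM : c ≤ M) (hz : ∀ t, ‖z t‖ ≤ M) (hT : 0 ≤ T) {δ : ℝ} (hδ : 0 < δ) (N : ℝ) :
    ∃ y ∈ dominatedFunctions E (growthBound M (a + 1) T) T,
      ∀ t ≤ N, y t = ∫ r in T..max T t, F r (segment h (z + y) (r - δ)) := by
  set S := dominatedFunctions E (growthBound M (a + 1) T) T with hS
  have hex : ∀ y : S, ∃ y' : S,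
      ∀ t, y'.1 t = ∫ r in T..max T t, F r (segment h (z + y.1) (r - δ)) := by
    rintro ⟨y, hy⟩
    obtain ⟨y', hy', h'⟩ := hF.exists_integral_operator hM hcM hz hT hy hδ.le
    exact ⟨⟨y', hy'⟩, h'⟩
  choose Ψ hΨ using hex
  have hzero : ∀ y : S, ∀ t ≤ T, y.1 t = 0 := by
    intro y t ht
    have := y.2.2 T t
    rw [growthBound_of_le ht, growthBound_of_le le_rfl, y.2.1] at this
    simpa using this
  let y₀ : S := ⟨0, by simp [hS, dominatedFunctions]⟩
  -- Method of steps: the integrand at r sees the curve only up to r - δ, so each iteration of the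
  -- operator fixes the curve on a further interval of length `δ`.
  have hagree : ∀ j : ℕ, ∀ t ≤ T + j * δ, (Ψ^[j] y₀).1 t = (Ψ^[j + 1] y₀).1 t := by
    intro j
    induction j with
    | zero =>
      intro t ht
      have ht' : t ≤ T := by simpa using ht
      rw [hzero _ t ht', hzero _ t ht']
    | succ j ih =>
      intro t ht
      rw [Function.iterate_succ_apply' Ψ (j + 1), hΨ, Function.iterate_succ_apply' Ψ j, hΨ,
        ← Function.iterate_succ_apply' Ψ j]
      refine intervalIntegral.integral_congr fun r hr => ?_
      rw [Set.uIcc_of_le (le_max_left _ _)] at hr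
      refine congrArg (F r) (segment_congr fun s hs => ?_)
      have hr2 : r ≤ T + (j + 1) * δ := by
        refine hr.2.trans (max_le ?_ ?_)
        · have : 0 ≤ (j + 1) * δ := by positivity
          linarith
        · exact_mod_cast ht
      simp only [ContinuousMap.add_apply]
      rw [ih s (by linarith [hs.2])]
  obtain ⟨j, hj⟩ := exists_nat_ge ((N - T) / δ)
  refine ⟨(Ψ^[j] y₀).1, (Ψ^[j] y₀).2, fun t ht => ?_⟩
  rw [div_le_iff₀ hδ] at hj
  rw [hagree j t (by linarith), Function.iterate_succ_apply', hΨ]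

theorem LinearGrowth.exists_fixed_point [FiniteDimensional ℝ E] (hF : LinearGrowth F a c)
    (hM : 0 ≤ M) (hcM : c ≤ M) (hz : ∀ t, ‖z t‖ ≤ M) (hT : 0 ≤ T) :
    ∃ y ∈ dominatedFunctions E (growthBound M (a + 1) T) T,
      ∀ t, y t = ∫ r in T..max T t, F r (segment h (z + y) r) := by
  have : ProperSpace E := FiniteDimensional.proper_real E
  have hpos : ∀ k : ℕ, (0 : ℝ) < 1 / (k + 1) := fun k => Nat.one_div_pos_of_nat
  -- The lag 1/(k+1) tends to zero while the horizon k tends to infinity, so every fixed time is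
  -- eventually covered.
  choose y hy hyk using fun k : ℕ => hF.exists_tonelli hM hcM hz hT (hpos k) k
  obtain ⟨x, hx, φ, hφ, hlim⟩ :=
    (isCompact_dominatedFunctions (E := E) (continuous_growthBound M (a + 1) T) T).tendsto_subseq hy
  refine ⟨x, hx, fun t => ?_⟩
  have h1 : Tendsto (fun k => y (φ k) t) atTop (𝓝 (x t)) :=
    ((ContinuousEvalConst.continuous_eval_const (F := C(ℝ, E)) t).tendsto x).comp hlim
  have h2 : Tendsto (fun k => ∫ r in T..max T t,
      F r (segment h (z + y (φ k)) (r - 1 / ((φ k : ℝ) + 1)))) atTop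
      (𝓝 (∫ r in T..max T t, F r (segment h (z + x) r))) := by
    have hsub : Set.uIoc T (max T t) ⊆ Set.Ici 0 := fun r hr =>
      hT.trans ((le_min le_rfl (le_max_left _ _)).trans hr.1.le)
    refine intervalIntegral.tendsto_integral_filter_of_dominated_convergence
      (fun r => (a + 1) * growthBound M (a + 1) T r) ?_ ?_
      (((continuous_growthBound M (a + 1) T).const_mul _).intervalIntegrable _ _) ?_
    · exact Eventually.of_forall fun k => (hF.aestronglyMeasurable_shift _ _).mono_measure
        (Measure.restrict_mono hsub le_rfl)
    · refine Eventually.of_forall fun k => ?_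
      have := (ae_restrict_iff' measurableSet_Ici).1 (hF.norm_le_growthBound (T := T) hM hcM hz)
      filter_upwards [this] with r hr hr'
      exact hr (hsub hr') _ (hy _) _ (hpos _).le
    · refine ae_of_all _ fun r _ => ((hF.continuous r).tendsto _).comp ?_
      have h3 : Tendsto (fun k => r - 1 / ((φ k : ℝ) + 1)) atTop (𝓝 (r - 0)) :=
        tendsto_const_nhds.sub (tendsto_one_div_add_atTop_nhds_zero_nat.comp hφ.tendsto_atTop)
      rw [sub_zero] at h3
      exact (continuous_segment_uncurry.tendsto (z + x, r)).comp
        ((tendsto_const_nhds.add hlim).prodMk_nhds h3)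
  refine tendsto_nhds_unique h1 (h2.congr' ?_)
  obtain ⟨k₀, hk₀⟩ := exists_nat_ge t
  filter_upwards [eventually_ge_atTop k₀] with k hk
  refine (hyk (φ k) t (hk₀.trans ?_)).symm
  exact_mod_cast hk.trans (hφ.id_le k)

/-- Solutions of Carathéodory functional differential equations with linear growth can be
continued to all future times. -/
theorem LinearGrowth.exists_continuation [FiniteDimensional ℝ E] (hF : LinearGrowth F a c)
    (hT : 0 ≤ T) (x₀ : C(ℝ, E)) :
    ∃ x : C(ℝ, E), (∀ t ∈ Set.Icc (-(h : ℝ)) T, x t = x₀ t) ∧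
      ∀ t, T ≤ t → IntervalIntegrable (fun s => F s (segment h x s)) volume T t ∧
        x t = x₀ T + ∫ s in T..t, F s (segment h x s) := by
  have hhT : -(h : ℝ) ≤ T := by linarith [h.coe_nonneg]
  -- The given curve is frozen outside [-h, T]; this makes it bounded, and the unknown becomes the
  -- deviation from it.
  let z : C(ℝ, E) := x₀.comp ⟨fun t => Set.projIcc (-(h : ℝ)) T hhT t, by fun_prop⟩
  have hzx : ∀ t ∈ Set.Icc (-(h : ℝ)) T, z t = x₀ t := fun t ht => by
    change x₀ (Set.projIcc (-(h : ℝ)) T hhT t) = x₀ t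
    rw [Set.projIcc_of_mem hhT ht]
  have hzT : ∀ t, T ≤ t → z t = x₀ T := fun t ht => by
    change x₀ (Set.projIcc (-(h : ℝ)) T hhT t) = x₀ T
    rw [Set.projIcc_of_right_le hhT ht]
  obtain ⟨B, hB⟩ := isCompact_Icc.exists_bound_of_continuousOn
    (s := Set.Icc (-(h : ℝ)) T) x₀.continuous.continuousOn
  have hz : ∀ t, ‖z t‖ ≤ max (max B c) 0 := fun t =>
    (hB _ (Set.projIcc (-(h : ℝ)) T hhT t).2).trans
      ((le_max_left _ _).trans (le_max_left _ _))
  have hcM : c ≤ max (max B c) 0 := (le_max_right _ _).trans (le_max_left _ _)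
  obtain ⟨y, hy, hfix⟩ := hF.exists_fixed_point (le_max_right _ _) hcM hz hT
  refine ⟨z + y, fun t ht => ?_, fun t ht => ⟨?_, ?_⟩⟩
  · have h0 : y t = 0 := by rw [hfix, max_eq_left ht.2, intervalIntegral.integral_same]
    rw [ContinuousMap.add_apply, h0, add_zero, hzx t ht]
  · simpa using hF.intervalIntegrable (le_max_right _ _) hcM hz hT hy le_rfl le_rfl ht
  · rw [ContinuousMap.add_apply, hzT t ht, hfix, max_eq_right ht]

end Existence

/-! ### Forward completeness and measurability along curves -/

section ForwardCompleteness

variable {E G : Type*} [NormedAddCommGroup E] [NormedAddCommGroup G] {h : ℝ≥0}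

theorem forwardComplete_of_linearGrowth [NormedSpace ℝ E] [FiniteDimensional ℝ E]
    {F : ℝ → Hist h E → G → E}
    (hF : ∀ w : ℝ → G, IsInput w → ∃ a c, LinearGrowth (fun s φ => F s φ (w s)) a c) :
    ForwardComplete F := by
  intro e₀ w hw T e he
  obtain ⟨a, c, hgrowth⟩ := hF w hw
  obtain ⟨x, hxe, hx⟩ := hgrowth.exists_continuation T.coe_nonneg e
  have hseg : ∀ s ∈ Set.Icc (0 : ℝ) T, segment h x s = segment h e s := fun s hs =>
    segment_congr fun r hr => hxe r ⟨by linarith [hr.1, hs.1], hr.2.trans hs.2⟩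
  have hh := h.coe_nonneg
  have hTnn := T.coe_nonneg
  have hcongr : ∀ t ∈ Set.Icc (0 : ℝ) T, ∫ s in (0 : ℝ)..t, F s (segment h x s) (w s) =
      ∫ s in (0 : ℝ)..t, F s (segment h e s) (w s) := fun t ht =>
    intervalIntegral.integral_congr fun s hs => by
      rw [Set.uIcc_of_le ht.1] at hs
      simp only [hseg s ⟨hs.1, hs.2.trans ht.2⟩]
  have hint0 : IntervalIntegrable (fun s => F s (segment h x s) (w s)) volume 0 T := by
    refine he.integrable.congr fun s hs => ?_
    rw [Set.uIoc_of_le hTnn] at hs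
    simp only [hseg s ⟨hs.1.le, hs.2⟩]
  have hx0 : x 0 = e 0 := hxe 0 ⟨by linarith, hTnn⟩
  refine ⟨x, fun T' => ⟨?_, ?_, fun t ht => ?_⟩, hxe⟩
  · rw [hseg 0 ⟨le_rfl, hTnn⟩, he.initial]
  · refine (hint0.trans (hx (max T T') (le_max_left _ _)).1).mono_set ?_
    rw [Set.uIcc_of_le T'.coe_nonneg, Set.uIcc_of_le (hTnn.trans (le_max_left _ _))]
    exact Set.Icc_subset_Icc_right (le_max_right _ _)
  · rcases le_total t T with htT | htT
    · rw [hcongr t ⟨ht.1, htT⟩, hx0, hxe t ⟨by linarith [ht.1], htT⟩]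
      exact he.eq_integral t ⟨ht.1, htT⟩
    · rw [(hx t htT).2, he.eq_integral T ⟨hTnn, le_rfl⟩, hx0,
        ← intervalIntegral.integral_add_adjacent_intervals hint0 (hx t htT).1,
        hcongr T ⟨hTnn, le_rfl⟩, add_assoc]

/-- Composing a Carathéodory function with a continuous curve gives a measurable function. -/
theorem Caratheodory.aestronglyMeasurable_comp [SecondCountableTopology E] {κ : E → ℝ → G}
    (hκ : Caratheodory κ) {x : ℝ → E} (hx : Continuous x) :
    AEStronglyMeasurable (fun s => κ (x s) s) volume := by
  have hxm : StronglyMeasurable x := hx.stronglyMeasurable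
  -- The curve is approximated by simple functions; continuity in the state passes to the limit, and
  -- on each fibre of a simple function the state argument is constant.
  refine aestronglyMeasurable_of_tendsto_ae atTop (f := fun n s => κ (hxm.approx n s) s) ?_
    (ae_of_all _ fun s => ((hκ.continuous s).tendsto _).comp (hxm.tendsto_approx s))
  intro n
  set f := hxm.approx n
  have hcover : (⋃ v : f.range, f ⁻¹' {v.1}) = Set.univ := by
    refine Set.eq_univ_of_forall fun s => Set.mem_iUnion.2 ⟨⟨f s, f.mem_range_self s⟩, rfl⟩
  rw [← Measure.restrict_univ (μ := (volume : Measure ℝ)), ← hcover,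
    aestronglyMeasurable_iUnion_iff]
  rintro ⟨v, -⟩
  refine ((hκ.measurable v).mono_measure Measure.restrict_le_self).congr ?_
  filter_upwards [ae_restrict_mem (f.measurableSet_fiber v)] with s hs
  have : f s = v := hs
  rw [this]

theorem norm_le_inputNorm {w : ℝ → G} (hw : IsInput w) :
    ∀ᵐ s ∂(volume.restrict (Set.Ici (0 : ℝ))), ‖w s‖ ≤ inputNorm w := by
  have hfin : eLpNormEssSup w (volume.restrict (Set.Ici 0)) ≠ ∞ := by
    have := hw.2.ne
    rwa [eLpNorm_exponent_top] at this
  filter_upwards [ae_le_eLpNormEssSup (f := w) (μ := volume.restrict (Set.Ici 0))] with s hs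
  have h1 : ‖w s‖₊ ≤ inputNorm w := by
    rw [inputNorm, eLpNorm_exponent_top]
    exact ENNReal.le_toNNReal_of_coe_le hs hfin
  exact_mod_cast h1

end ForwardCompleteness

/-! ### Linear growth of the closed loop -/

section Linear

variable {n : ℕ} {h : ℝ≥0}

theorem closedLoop_linearGrowth (A A₁ : Matrix (Fin n) (Fin n) ℝ) {γ : ℝ≥0}
    {κ : EuclideanSpace ℝ (Fin n) → ℝ → EuclideanSpace ℝ (Fin n)} (hκ : Caratheodory κ)
    (hbound : ∀ ξ t, ‖κ ξ t‖₊ ≤ γ * ‖ξ‖₊) {w : ℝ → EuclideanSpace ℝ (Fin n)} (hw : IsInput w) :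
    LinearGrowth (fun s φ => closedLoop (linearDelay h A A₁) κ s φ (w s))
      (‖A.toEuclideanLin.toContinuousLinearMap‖ + ‖A₁.toEuclideanLin.toContinuousLinearMap‖ + γ)
      (inputNorm w) where
  nonneg := by positivity
  continuous s := by
    have h1 : Continuous fun φ : Hist h (EuclideanSpace ℝ (Fin n)) => φ.now :=
      ContinuousEvalConst.continuous_eval_const _
    have h2 : Continuous fun φ : Hist h (EuclideanSpace ℝ (Fin n)) => φ.delayed :=
      ContinuousEvalConst.continuous_eval_const _
    have h3 := (hκ.continuous s).comp h1
    exact (((A.toEuclideanLin.toContinuousLinearMap.continuous.comp h1).add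
      (A₁.toEuclideanLin.toContinuousLinearMap.continuous.comp h2)).add
      (h3.add continuous_const))
  measurable x := by
    have h1 : Continuous fun s => (segment h x s).now := by
      change Continuous fun s => x (s + 0)
      fun_prop
    have h2 : Continuous fun s => (segment h x s).delayed := by
      change Continuous fun s => x (s + -(h : ℝ))
      fun_prop
    refine AEStronglyMeasurable.add (AEStronglyMeasurable.add ?_ ?_)
      (((hκ.aestronglyMeasurable_comp h1).mono_measure Measure.restrict_le_self).add hw.1)
    · exact (A.toEuclideanLin.toContinuousLinearMap.continuous.comp h1).aestronglyMeasurable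
    · exact (A₁.toEuclideanLin.toContinuousLinearMap.continuous.comp h2).aestronglyMeasurable
  bound := by
    filter_upwards [norm_le_inputNorm hw] with s hs φ
    have h1 : ‖φ.now‖ ≤ ‖φ‖ := φ.norm_coe_le_norm _
    have h2 : ‖φ.delayed‖ ≤ ‖φ‖ := φ.norm_coe_le_norm _
    have h3 : ‖κ φ.now s‖ ≤ γ * ‖φ.now‖ := by exact_mod_cast hbound φ.now s
    have h4 := A.toEuclideanLin.toContinuousLinearMap.le_of_opNorm_le_of_le le_rfl h1
    have h5 := A₁.toEuclideanLin.toContinuousLinearMap.le_of_opNorm_le_of_le le_rfl h2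
    have h6 := mul_le_mul_of_nonneg_left h1 γ.coe_nonneg
    calc ‖closedLoop (linearDelay h A A₁) κ s φ (w s)‖
        ≤ ‖A.toEuclideanLin φ.now‖ + ‖A₁.toEuclideanLin φ.delayed‖ + (‖κ φ.now s‖ + ‖w s‖) :=
          (norm_add_le _ _).trans (add_le_add (norm_add_le _ _) (norm_add_le _ _))
      _ ≤ _ := by
        simp only [LinearMap.coe_toContinuousLinearMap'] at h4 h5
        linarith

theorem closedLoop_forwardComplete (A A₁ : Matrix (Fin n) (Fin n) ℝ) {γ : ℝ≥0}
    {κ : EuclideanSpace ℝ (Fin n) → ℝ → EuclideanSpace ℝ (Fin n)} (hκ : Caratheodory κ)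
    (hbound : ∀ ξ t, ‖κ ξ t‖₊ ≤ γ * ‖ξ‖₊) :
    ForwardComplete (closedLoop (linearDelay h A A₁) κ) :=
  forwardComplete_of_linearGrowth fun _ hw => ⟨_, _, closedLoop_linearGrowth A A₁ hκ hbound hw⟩

end Linear

/-! ### Gronwall's inequality and weighted delay integrals -/

section IntegralInequalities

/-- Gronwall's inequality in integral form. -/
theorem le_mul_exp_of_le_add_integral {u : ℝ → ℝ} {c K T : ℝ} (hu : Continuous u)
    (hu0 : ∀ t, 0 ≤ u t) (hK : 0 < K)
    (h : ∀ t ∈ Set.Icc 0 T, u t ≤ c + K * ∫ s in (0 : ℝ)..t, u s) :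
    ∀ t ∈ Set.Icc 0 T, u t ≤ c * Real.exp (K * t) := by
  intro t ht
  have hd : ∀ t, HasDerivAt (fun t => ∫ s in (0 : ℝ)..t, u s) (u t) t := fun t =>
    intervalIntegral.integral_hasDerivAt_right (hu.intervalIntegrable _ _)
      (hu.stronglyMeasurableAtFilter _ _) hu.continuousAt
  have hnn : ∀ t ∈ Set.Icc 0 T, 0 ≤ ∫ s in (0 : ℝ)..t, u s := fun t ht =>
    intervalIntegral.integral_nonneg ht.1 fun s _ => hu0 s
  -- The differential Gronwall inequality is applied to the primitive U of `u`, where U(0) = 0 and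
  -- U' ≤ c + K U; its bound on U is then put back into the hypothesis.
  have key := norm_le_gronwallBound_of_norm_deriv_right_le (δ := 0) (K := K) (ε := c)
    (a := 0) (b := T) (f := fun t => ∫ s in (0 : ℝ)..t, u s) (f' := u)
    (fun t _ => (hd t).continuousAt.continuousWithinAt)
    (fun t _ => (hd t).hasDerivWithinAt) (by simp)
    (fun s hs => by
      have hs' : s ∈ Set.Icc 0 T := ⟨hs.1, hs.2.le⟩
      rw [Real.norm_of_nonneg (hu0 s), Real.norm_of_nonneg (hnn s hs')]
      linarith [h s hs']) t ht
  rw [Real.norm_of_nonneg (hnn t ht), gronwallBound_of_K_ne_0 hK.ne', sub_zero] at key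
  simp only [zero_mul, zero_add] at key
  have h1 := mul_le_mul_of_nonneg_left key hK.le
  have h2 : K * (c / K * (Real.exp (K * t) - 1)) = c * Real.exp (K * t) - c := by
    field_simp
  linarith [h t ht]

/-- Each s is counted for t in a window of length at most `h`. In terms of the primitive D, the
double integral is that of D(t) - D(t-h), which telescopes to the integral of D over [τ-h, τ] minus
that over [0, h]; monotonicity of D finishes. -/
theorem integral_integral_delay_le {r : ℝ → ℝ} {h τ : ℝ} (hh : 0 ≤ h) (hhτ : h ≤ τ)
    (hr : IntervalIntegrable r volume 0 τ) (hr0 : ∀ s, 0 ≤ r s) :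
    ∫ t in h..τ, ∫ s in (t - h)..t, r s ≤ h * ∫ s in (0 : ℝ)..τ, r s := by
  have h0τ := hh.trans hhτ
  set D : ℝ → ℝ := fun t => ∫ s in (0 : ℝ)..t, r s with hD
  have hint : ∀ {s t}, s ∈ Set.Icc 0 τ → t ∈ Set.Icc 0 τ → IntervalIntegrable r volume s t := by
    intro s t hs ht
    refine hr.mono_set ?_
    rw [Set.uIcc_of_le h0τ]
    exact Set.uIcc_subset_Icc hs ht
  have hDcont : ContinuousOn D (Set.Icc 0 τ) := by
    have := intervalIntegral.continuousOn_primitive_interval' hr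
      (Set.left_mem_uIcc (a := (0 : ℝ)) (b := τ))
    rwa [Set.uIcc_of_le h0τ] at this
  have hDint : ∀ {s t}, s ∈ Set.Icc 0 τ → t ∈ Set.Icc 0 τ →
      IntervalIntegrable D volume s t := fun hs ht =>
    (hDcont.mono (Set.uIcc_subset_Icc hs ht)).intervalIntegrable
  have hmono : ∀ {s t}, s ∈ Set.Icc 0 τ → t ∈ Set.Icc 0 τ → s ≤ t → D s ≤ D t := by
    intro s t hs ht hst
    have h1 : D t - D s = ∫ r' in s..t, r r' :=
      intervalIntegral.integral_interval_sub_left (hint ⟨le_rfl, h0τ⟩ ht) (hint ⟨le_rfl, h0τ⟩ hs)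
    have h2 := intervalIntegral.integral_nonneg (μ := volume) hst fun s _ => hr0 s
    linarith
  have m0 : (0 : ℝ) ∈ Set.Icc 0 τ := ⟨le_rfl, h0τ⟩
  have mh : h ∈ Set.Icc 0 τ := ⟨hh, hhτ⟩
  have mτ : τ ∈ Set.Icc 0 τ := ⟨h0τ, le_rfl⟩
  have mτh : τ - h ∈ Set.Icc 0 τ := ⟨by linarith, by linarith⟩
  have hshift : IntervalIntegrable (fun t => D (t - h)) volume h τ := by
    have := (hDint m0 mτh).comp_sub_right h
    simpa using this
  have e1 : ∫ t in h..τ, ∫ s in (t - h)..t, r s = ∫ t in h..τ, (D t - D (t - h)) := by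
    refine intervalIntegral.integral_congr fun t ht => ?_
    rw [Set.uIcc_of_le hhτ] at ht
    exact (intervalIntegral.integral_interval_sub_left
      (hint m0 ⟨hh.trans ht.1, ht.2⟩) (hint m0 ⟨by linarith [ht.1], by linarith [ht.2]⟩)).symm
  have e2 : ∫ t in h..τ, D (t - h) = ∫ t in (0 : ℝ)..(τ - h), D t := by
    rw [intervalIntegral.integral_comp_sub_right (fun t => D t) h, sub_self]
  have e3 := intervalIntegral.integral_add_adjacent_intervals (hDint m0 mh) (hDint mh mτ)
  have e4 := intervalIntegral.integral_add_adjacent_intervals (hDint m0 mτh) (hDint mτh mτ)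
  have e5 : 0 ≤ ∫ t in (0 : ℝ)..h, D t := by
    refine intervalIntegral.integral_nonneg hh fun t ht => ?_
    exact intervalIntegral.integral_nonneg ht.1 fun s _ => hr0 s
  have e6 : ∫ t in (τ - h)..τ, D t ≤ ∫ _ in (τ - h)..τ, D τ := by
    refine intervalIntegral.integral_mono_on (by linarith) (hDint mτh mτ)
      intervalIntegrable_const fun t ht => ?_
    exact hmono ⟨by linarith [ht.1], ht.2⟩ mτ ht.2
  rw [intervalIntegral.integral_const, smul_eq_mul, sub_sub_cancel] at e6
  rw [e1, intervalIntegral.integral_sub (hDint mh mτ) hshift, e2]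
  change _ ≤ h * D τ
  linarith

theorem integral_exp_mul_delay_le {r : ℝ → ℝ} {h τ k : ℝ} (hh : 0 ≤ h) (hhτ : h ≤ τ)
    (hr : IntervalIntegrable r volume 0 τ) (hr0 : ∀ s, 0 ≤ r s) :
    ∫ t in h..τ, Real.exp (k * t) * r (t - h) ≤
      Real.exp (k * h) * ∫ s in (0 : ℝ)..τ, Real.exp (k * s) * r s := by
  have e1 : ∫ t in h..τ, Real.exp (k * t) * r (t - h) =
      ∫ s in (0 : ℝ)..(τ - h), Real.exp (k * h) * (Real.exp (k * s) * r s) := by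
    have := intervalIntegral.integral_comp_sub_right (a := h) (b := τ)
      (fun s => Real.exp (k * h) * (Real.exp (k * s) * r s)) h
    rw [sub_self] at this
    rw [← this]
    refine intervalIntegral.integral_congr fun t _ => ?_
    rw [← mul_assoc, ← Real.exp_add]
    congr 2
    ring
  rw [e1, intervalIntegral.integral_const_mul]
  refine mul_le_mul_of_nonneg_left ?_ (Real.exp_pos _).le
  refine intervalIntegral.integral_mono_interval le_rfl (by linarith) (by linarith)
    (ae_of_all _ fun s => mul_nonneg (Real.exp_pos _).le (hr0 s)) ?_
  exact hr.continuousOn_mul (by fun_prop)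

theorem continuousOn_integral_delay {r : ℝ → ℝ} {h τ : ℝ} (hh : 0 ≤ h) (hhτ : h ≤ τ)
    (hr : IntervalIntegrable r volume 0 τ) :
    ContinuousOn (fun t => ∫ s in (t - h)..t, r s) (Set.Icc h τ) := by
  have h0τ := hh.trans hhτ
  have hp := intervalIntegral.continuousOn_primitive_interval' hr
    (Set.left_mem_uIcc (a := (0 : ℝ)) (b := τ))
  rw [Set.uIcc_of_le h0τ] at hp
  have h1 : ContinuousOn (fun t => ∫ s in (0 : ℝ)..t, r s) (Set.Icc h τ) :=
    hp.mono (Set.Icc_subset_Icc_left hh)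
  have h2 : ContinuousOn (fun t => ∫ s in (0 : ℝ)..(t - h), r s) (Set.Icc h τ) :=
    hp.comp (f := fun t => t - h) (by fun_prop)
      fun t ht => ⟨by linarith [ht.1], by linarith [ht.2]⟩
  refine (h1.sub h2).congr fun t ht => ?_
  refine (intervalIntegral.integral_interval_sub_left (hr.mono_set ?_) (hr.mono_set ?_)).symm
  · rw [Set.uIcc_of_le h0τ, Set.uIcc_of_le (hh.trans ht.1)]
    exact Set.Icc_subset_Icc_right ht.2
  · rw [Set.uIcc_of_le h0τ, Set.uIcc_of_le (by linarith [ht.1])]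
    exact Set.Icc_subset_Icc_right (by linarith [ht.2])

/-- For s ≥ t - h the weight satisfies exp(kt) ≤ exp(kh) exp(ks), which reduces the claim to the
unweighted inequality for exp(ks) r(s). -/
theorem integral_exp_mul_integral_delay_le {r : ℝ → ℝ} {h τ k : ℝ} (hh : 0 ≤ h) (hhτ : h ≤ τ)
    (hk : 0 ≤ k) (hr : IntervalIntegrable r volume 0 τ) (hr0 : ∀ s, 0 ≤ r s) :
    ∫ t in h..τ, Real.exp (k * t) * ∫ s in (t - h)..t, r s ≤
      Real.exp (k * h) * (h * ∫ s in (0 : ℝ)..τ, Real.exp (k * s) * r s) := by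
  have h0τ := hh.trans hhτ
  have hr' : IntervalIntegrable (fun s => Real.exp (k * s) * r s) volume 0 τ :=
    hr.continuousOn_mul (by fun_prop)
  refine le_trans ?_ (mul_le_mul_of_nonneg_left (integral_integral_delay_le hh hhτ hr'
    fun s => mul_nonneg (Real.exp_pos _).le (hr0 s)) (Real.exp_pos _).le)
  rw [← intervalIntegral.integral_const_mul]
  refine intervalIntegral.integral_mono_on hhτ ?_ ?_ fun t ht => ?_
  · refine ContinuousOn.intervalIntegrable ?_
    rw [Set.uIcc_of_le hhτ]
    exact ContinuousOn.mul (by fun_prop) (continuousOn_integral_delay hh hhτ hr)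
  · refine ContinuousOn.intervalIntegrable ?_
    rw [Set.uIcc_of_le hhτ]
    exact ContinuousOn.mul (by fun_prop) (continuousOn_integral_delay hh hhτ hr')
  · rw [← intervalIntegral.integral_const_mul, ← intervalIntegral.integral_const_mul]
    have hsub : Set.uIcc (t - h) t ⊆ Set.uIcc 0 τ := by
      rw [Set.uIcc_of_le h0τ, Set.uIcc_of_le (by linarith)]
      exact Set.Icc_subset_Icc (by linarith [ht.1]) ht.2
    refine intervalIntegral.integral_mono_on (by linarith) ((hr.mono_set hsub).const_mul _)
      ((hr'.mono_set hsub).const_mul _) fun s hs => ?_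
    rw [← mul_assoc, ← Real.exp_add]
    refine mul_le_mul_of_nonneg_right (Real.exp_le_exp.2 ?_) (hr0 s)
    nlinarith [hs.1]

end IntegralInequalities

/-! ### Quadratic forms along Lipschitz curves -/

section QuadraticForms

variable {E : Type*} [NormedAddCommGroup E] [InnerProductSpace ℝ E]

theorem inner_apply_le (R : E →L[ℝ] E) (x : E) : inner ℝ x (R x) ≤ ‖R‖ * ‖x‖ ^ 2 := by
  have h1 := real_inner_le_norm x (R x)
  have h2 := mul_le_mul_of_nonneg_left (R.le_opNorm x) (norm_nonneg x)
  nlinarith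

/-- Jensen's inequality for the quadratic form of a positive operator. -/
theorem inner_integral_le [CompleteSpace E] {R : E →L[ℝ] E}
    (hsymm : ∀ x y, inner ℝ x (R y) = inner ℝ y (R x))
    (hpos : ∀ x, 0 ≤ inner ℝ x (R x)) {d : ℝ → E} {a b : ℝ} (hab : a ≤ b)
    (hd : IntervalIntegrable d volume a b)
    (hRd : IntervalIntegrable (fun s => inner ℝ (d s) (R (d s))) volume a b) :
    inner ℝ (∫ s in a..b, d s) (R (∫ s in a..b, d s)) ≤
      (b - a) * ∫ s in a..b, inner ℝ (d s) (R (d s)) := by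
  rcases hab.eq_or_lt with rfl | hlt
  · simp
  have hba : 0 < b - a := sub_pos.2 hlt
  set I := ∫ s in a..b, d s with hI
  set c := (b - a)⁻¹ • I with hc
  -- Positivity of the form at d(s) - c, with c the mean of `d`, gives the supporting affine
  -- function at c; integrating it yields Jensen.
  have hpt : ∀ s, 2 * inner ℝ (R c) (d s) - inner ℝ c (R c) ≤ inner ℝ (d s) (R (d s)) := by
    intro s
    have h1 := hpos (d s - c)
    rw [map_sub, inner_sub_left, inner_sub_right, inner_sub_right, hsymm c (d s)] at h1
    rw [real_inner_comm]
    linarith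
  have hi : IntervalIntegrable (fun s => inner ℝ (R c) (d s)) volume a b :=
    ⟨(innerSL ℝ (R c)).integrable_comp hd.1, (innerSL ℝ (R c)).integrable_comp hd.2⟩
  have h2 := intervalIntegral.integral_mono_on hab
    ((hi.const_mul 2).sub (intervalIntegrable_const (c := inner ℝ c (R c)))) hRd fun s _ => hpt s
  have h3 : ∫ s in a..b, inner ℝ (R c) (d s) = inner ℝ (R c) I :=
    (innerSL ℝ (R c)).intervalIntegral_comp_comm hd
  rw [intervalIntegral.integral_sub (hi.const_mul 2) intervalIntegrable_const,
    intervalIntegral.integral_const_mul, h3, intervalIntegral.integral_const, smul_eq_mul] at h2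
  have h4 : inner ℝ (R c) I = (b - a)⁻¹ * inner ℝ I (R I) := by
    rw [hc, map_smul, inner_smul_left, real_inner_comm]
    simp
  have h5 : inner ℝ c (R c) = (b - a)⁻¹ * ((b - a)⁻¹ * inner ℝ I (R I)) := by
    rw [hc, map_smul, inner_smul_left, inner_smul_right]
    simp
  rw [h4, h5] at h2
  have h6 := mul_le_mul_of_nonneg_left h2 hba.le
  refine le_trans (le_of_eq ?_) h6
  field_simp
  ring

theorem intervalIntegrable_inner_apply (R : E →L[ℝ] E) {d : ℝ → E} {a b D : ℝ}
    (hd : IntervalIntegrable d volume a b)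
    (hD : ∀ᵐ s ∂(volume.restrict (Set.uIoc a b)), ‖d s‖ ≤ D) :
    IntervalIntegrable (fun s => inner ℝ (d s) (R (d s))) volume a b := by
  have hm := hd.def'.aestronglyMeasurable
  refine (intervalIntegrable_const (c := D * (‖R‖ * D))).mono_fun
    (hm.inner (R.continuous.comp_aestronglyMeasurable hm)) ?_
  filter_upwards [hD] with s hs
  have hD0 : 0 ≤ D := (norm_nonneg _).trans hs
  refine (norm_inner_le_norm _ _).trans (le_trans ?_ (Real.le_norm_self _))
  exact mul_le_mul hs (R.le_opNorm_of_le hs) (norm_nonneg _) hD0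

/-- The fundamental theorem of calculus for an exponentially weighted quadratic form along a
Lipschitz curve. -/
theorem exp_mul_inner_sub_eq_integral [CompleteSpace E] {P : E →L[ℝ] E}
    (hsymm : ∀ x y, inner ℝ x (P y) = inner ℝ y (P x)) {e d : ℝ → E} {a b T D : ℝ} (k : ℝ)
    (ha : 0 ≤ a) (hab : a ≤ b) (hbT : b ≤ T)
    (hd : IntervalIntegrable d volume 0 T)
    (hD : ∀ᵐ s ∂(volume.restrict (Set.uIoc 0 T)), ‖d s‖ ≤ D)
    (he : ∀ t ∈ Set.Icc 0 T, e t = e 0 + ∫ s in (0 : ℝ)..t, d s) :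
    Real.exp (k * b) * inner ℝ (e b) (P (e b)) - Real.exp (k * a) * inner ℝ (e a) (P (e a)) =
      ∫ t in a..b, Real.exp (k * t) *
        (k * inner ℝ (e t) (P (e t)) + 2 * inner ℝ (d t) (P (e t))) := by
  have h0T : 0 ≤ T := ha.trans (hab.trans hbT)
  have hint : ∀ {s t}, s ∈ Set.Icc 0 T → t ∈ Set.Icc 0 T → IntervalIntegrable d volume s t := by
    intro s t hs ht
    refine hd.mono_set ?_
    rw [Set.uIcc_of_le h0T]
    exact Set.uIcc_subset_Icc hs ht
  have m0 : (0 : ℝ) ∈ Set.Icc 0 T := ⟨le_rfl, h0T⟩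
  have hsub : Set.uIcc a b ⊆ Set.Icc 0 T := by
    rw [Set.uIcc_of_le hab]
    exact Set.Icc_subset_Icc ha hbT
  rw [Set.uIoc_of_le h0T, ae_restrict_iff' measurableSet_Ioc] at hD
  have hlip : LipschitzOnWith D.toNNReal e (Set.Icc 0 T) := by
    refine LipschitzOnWith.of_dist_le_mul fun s hs t ht => ?_
    rw [dist_eq_norm, he s hs, he t ht, add_sub_add_left_eq_sub,
      intervalIntegral.integral_interval_sub_left (hint m0 hs) (hint m0 ht), Real.dist_eq]
    refine intervalIntegral.norm_integral_le_of_norm_le_const_ae ?_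
    filter_upwards [hD] with r hr hr'
    refine (hr ?_).trans (Real.le_coe_toNNReal D)
    exact ⟨(le_min ht.1 hs.1).trans_lt hr'.1, hr'.2.trans (max_le ht.2 hs.2)⟩
  obtain ⟨B, hB⟩ := isCompact_Icc.exists_bound_of_continuousOn hlip.continuousOn
  have hqlip : LipschitzOnWith (D.toNNReal * (2 * ‖P‖₊ * B.toNNReal))
      (fun t => inner ℝ (e t) (P (e t))) (Set.Icc 0 T) := by
    refine LipschitzOnWith.of_dist_le_mul fun s hs t ht => ?_
    -- Symmetry of `P` factors the difference of squares, so the quadratic form inherits the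
    -- Lipschitz property from `e`.
    have h1 : inner ℝ (e s) (P (e s)) - inner ℝ (e t) (P (e t)) =
        inner ℝ (e s - e t) (P (e s + e t)) := by
      rw [map_add, inner_sub_left, inner_add_right, inner_add_right, hsymm (e t) (e s)]
      ring
    have h2 := hlip.dist_le_mul s hs t ht
    have h3 : ‖e s + e t‖ ≤ 2 * B.toNNReal := by
      have := norm_add_le (e s) (e t)
      linarith [(hB s hs).trans (Real.le_coe_toNNReal B),
        (hB t ht).trans (Real.le_coe_toNNReal B)]
    rw [Real.dist_eq, h1]
    rw [dist_eq_norm] at h2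
    calc |inner ℝ (e s - e t) (P (e s + e t))| ≤ ‖e s - e t‖ * ‖P (e s + e t)‖ :=
          abs_real_inner_le_norm _ _
      _ ≤ (D.toNNReal * dist s t) * (‖P‖ * (2 * B.toNNReal)) :=
          mul_le_mul h2 (P.le_opNorm_of_le h3) (norm_nonneg _) (by positivity)
      _ = _ := by
        push_cast
        ring
  have hac : AbsolutelyContinuousOnInterval
      (fun t => Real.exp (k * t) * inner ℝ (e t) (P (e t))) a b := by
    refine AbsolutelyContinuousOnInterval.fun_mul ?_
      (hqlip.mono hsub).absolutelyContinuousOnInterval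
    refine ContDiffOn.absolutelyContinuousOnInterval (ContDiff.contDiffOn ?_)
    fun_prop
  rw [← hac.integral_deriv_eq_sub]
  refine intervalIntegral.integral_congr_ae ?_
  -- The endpoint is discarded because `b` may equal `T`, and `e` is known to be a primitive only on
  -- [0, T].
  have hne : ∀ᵐ t : ℝ, t ≠ b := by simp [ae_iff, measure_singleton]
  filter_upwards [hd.ae_hasDerivAt_integral, hne] with t ht htb htab
  rw [Set.uIoc_of_le hab] at htab
  have htT : t ∈ Set.uIcc 0 T := by
    rw [Set.uIcc_of_le h0T]
    exact ⟨ha.trans htab.1.le, htab.2.trans hbT⟩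
  have hint' := ht htT 0 Set.left_mem_uIcc
  have hmem : Set.Icc 0 T ∈ 𝓝 t := Icc_mem_nhds (ha.trans_lt htab.1)
    ((lt_of_le_of_ne htab.2 htb).trans_le hbT)
  have hde : HasDerivAt e (d t) t := by
    refine (hint'.const_add (e 0)).congr_of_eventuallyEq ?_
    filter_upwards [hmem] with s hs using he s hs
  have hdq : HasDerivAt (fun t => inner ℝ (e t) (P (e t)))
      (inner ℝ (e t) (P (d t)) + inner ℝ (d t) (P (e t))) t :=
    hde.inner ℝ (P.hasFDerivAt.comp_hasDerivAt t hde)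
  have hdexp : HasDerivAt (fun t => Real.exp (k * t)) (Real.exp (k * t) * k) t := by
    simpa using ((hasDerivAt_id t).const_mul k).exp
  rw [(hdexp.fun_mul hdq).deriv, hsymm (e t) (d t)]
  ring

end QuadraticForms

/-! ### The integrated dissipation inequality -/

section Estimate

variable {E : Type*} [NormedAddCommGroup E] [InnerProductSpace ℝ E]

/-- `e` is a trajectory on `[-h, T]`, with derivative `d`, of the linear delay system with matrices
`A`, `A₁`, driven by a perturbation bounded by `γ ‖e‖ + ω`; its initial function is bounded
by `m`. -/
structure IsPerturbedTrajectory (A A₁ : E →L[ℝ] E) (h γ ω m T : ℝ) (e : C(ℝ, E)) (d : ℝ → E) :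
    Prop where
  nonneg : 0 ≤ T
  integrable : IntervalIntegrable d volume 0 T
  eq_integral : ∀ t ∈ Set.Icc 0 T, e t = e 0 + ∫ s in (0 : ℝ)..t, d s
  bound : ∀ᵐ s ∂(volume.restrict (Set.Ioc 0 T)),
    ‖d s - (A (e s) + A₁ (e (s - h)))‖ ≤ γ * ‖e s‖ + ω
  initial : ∀ t ∈ Set.Icc (-h) 0, ‖e t‖ ≤ m

variable {A A₁ P R S : E →L[ℝ] E} {h γ ω m T : ℝ} {e : C(ℝ, E)} {d : ℝ → E}

theorem IsPerturbedTrajectory.norm_deriv_le (he : IsPerturbedTrajectory A A₁ h γ ω m T e d)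
    (hh : 0 ≤ h) (hγ : 0 ≤ γ) {t B : ℝ} (htT : t ≤ T)
    (hB : ∀ s ∈ Set.Icc (-h) t, ‖e s‖ ≤ B) :
    ∀ᵐ s ∂(volume.restrict (Set.Ioc 0 t)), ‖d s‖ ≤ (‖A‖ + ‖A₁‖ + γ) * B + ω := by
  filter_upwards [ae_restrict_of_ae_restrict_of_subset (Set.Ioc_subset_Ioc_right htT) he.bound,
    ae_restrict_mem measurableSet_Ioc] with s hs hst
  have h1 := hB s ⟨by linarith [hst.1], hst.2⟩
  have h2 := hB (s - h) ⟨by linarith [hst.1], by linarith [hst.2]⟩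
  have h3 := A.le_opNorm_of_le h1
  have h4 := A₁.le_opNorm_of_le h2
  have h5 := norm_add_le (A (e s)) (A₁ (e (s - h)))
  have h6 := norm_le_norm_add_norm_sub' (d s) (A (e s) + A₁ (e (s - h)))
  have h7 := mul_le_mul_of_nonneg_left h1 hγ
  linarith

/-- Up to time `h` the state is controlled by Gronwall's inequality. -/
theorem IsPerturbedTrajectory.norm_le_initial [CompleteSpace E]
    (he : IsPerturbedTrajectory A A₁ h γ ω m T e d)
    (hh : 0 ≤ h) (hγ : 0 ≤ γ) (hω : 0 ≤ ω) {t : ℝ} (htT : t ≤ T) (ht : t ∈ Set.Icc (-h) h) :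
    ‖e t‖ ≤ (1 + h * (‖A₁‖ + 1)) * Real.exp ((‖A‖ + γ + 1) * h) * (m + ω) := by
  have hm : 0 ≤ m := (norm_nonneg _).trans (he.initial 0 ⟨by linarith, le_rfl⟩)
  have hA := norm_nonneg A
  have hA₁ := norm_nonneg A₁
  have hexp : 1 ≤ Real.exp ((‖A‖ + γ + 1) * h) := Real.one_le_exp (by positivity)
  rcases le_total t 0 with ht0 | ht0
  · have h1 := he.initial t ⟨ht.1, ht0⟩
    have h2 : 1 ≤ (1 + h * (‖A₁‖ + 1)) * Real.exp ((‖A‖ + γ + 1) * h) :=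
      one_le_mul_of_one_le_of_one_le (le_add_of_nonneg_right (by positivity)) hexp
    nlinarith
  have hK : 0 < ‖A‖ + γ + 1 := by positivity
  have key := le_mul_exp_of_le_add_integral (u := fun s => ‖e s‖)
    (c := (1 + h * (‖A₁‖ + 1)) * (m + ω)) (K := ‖A‖ + γ + 1) (T := t) (by fun_prop)
    (fun _ => norm_nonneg _) hK ?_ t ⟨ht0, le_rfl⟩
  · have h1 : Real.exp ((‖A‖ + γ + 1) * t) ≤ Real.exp ((‖A‖ + γ + 1) * h) :=
      Real.exp_le_exp.2 (mul_le_mul_of_nonneg_left ht.2 hK.le)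
    refine key.trans ?_
    rw [mul_right_comm]
    gcongr
  · intro s hs
    have hsT : s ≤ T := hs.2.trans htT
    have hsh : s ≤ h := hs.2.trans ht.2
    -- For r ≤ h the delayed argument r - h still lies in the initial interval, so the delayed term
    -- is a constant and Gronwall sees only the current state.
    have h1 : ‖∫ r in (0 : ℝ)..s, d r‖ ≤
        ∫ r in (0 : ℝ)..s, ((‖A‖ + γ + 1) * ‖e r‖ + (‖A₁‖ * m + ω)) := by
      refine intervalIntegral.norm_integral_le_of_norm_le hs.1 ?_
        (Continuous.intervalIntegrable (by fun_prop) _ _)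
      rw [← ae_restrict_iff' measurableSet_Ioc]
      filter_upwards [ae_restrict_of_ae_restrict_of_subset
        (Set.Ioc_subset_Ioc_right hsT) he.bound, ae_restrict_mem measurableSet_Ioc] with r hr hrs
      have h3 := A.le_opNorm (e r)
      have h4 := A₁.le_opNorm_of_le
        (he.initial (r - h) ⟨by linarith [hrs.1], by linarith [hrs.2]⟩)
      have h5 := norm_add_le (A (e r)) (A₁ (e (r - h)))
      have h6 := norm_le_norm_add_norm_sub' (d r) (A (e r) + A₁ (e (r - h)))
      linarith [norm_nonneg (e r)]
    rw [intervalIntegral.integral_add (Continuous.intervalIntegrable (by fun_prop) _ _)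
      intervalIntegrable_const, intervalIntegral.integral_const_mul,
      intervalIntegral.integral_const, sub_zero, smul_eq_mul] at h1
    have h2 := he.eq_integral s ⟨hs.1, hsT⟩
    have h3 := norm_add_le (e 0) (∫ r in (0 : ℝ)..s, d r)
    rw [← h2] at h3
    have h4 := he.initial 0 ⟨by linarith, le_rfl⟩
    have h5 : s * (‖A₁‖ * m + ω) ≤ h * (‖A₁‖ * m + ω) := by gcongr
    have h6 : 0 ≤ h * (m + ‖A₁‖ * ω) := by positivity
    linarith

/-- The pointwise form of the dissipation inequality behind the Lyapunov–Krasovskii functional. -/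
def IsDissipative (A A₁ P R S : E →L[ℝ] E) (h γ ε : ℝ) : Prop :=
  ∀ x y z v : E, y = A x + A₁ z + v →
    2 * inner ℝ y (P x) + inner ℝ x (S x) - inner ℝ z (S z) + h ^ 2 * inner ℝ y (R y) -
      inner ℝ (x - z) (R (x - z)) + γ ^ 2 * ‖x‖ ^ 2 - ‖v‖ ^ 2 ≤ -ε * (‖x‖ ^ 2 + ‖y‖ ^ 2)

/-- Young's inequality bounds the cross term 2γ‖x‖ω by (ε/2)‖x‖² + (2γ²/ε)ω². The remaining
(ε/2)‖x‖² and ε‖y‖² pay for k⟨x,Px⟩ and for multiplying the S- and R-terms by exp(kh), the price of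
shifting the weight by one delay. -/
theorem IsDissipative.weighted_le {ε k : ℝ} (hL : IsDissipative A A₁ P R S h γ ε) (hε : 0 < ε)
    (hh : 0 ≤ h) (hk : 0 ≤ k) (hS : k * ‖P‖ + (Real.exp (k * h) - 1) * ‖S‖ ≤ ε / 2)
    (hR : (Real.exp (k * h) - 1) * (h ^ 2 * ‖R‖) ≤ ε) {x y z : E}
    (hω : ‖y - (A x + A₁ z)‖ ≤ γ * ‖x‖ + ω) :
    k * inner ℝ x (P x) + 2 * inner ℝ y (P x) ≤
      inner ℝ z (S z) - Real.exp (k * h) * inner ℝ x (S x) +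
        (inner ℝ (x - z) (R (x - z)) - Real.exp (k * h) * h ^ 2 * inner ℝ y (R y)) +
        (1 + 2 * γ ^ 2 / ε) * ω ^ 2 := by
  have h1 := hL x y z (y - (A x + A₁ z)) (by abel)
  have h2 : ‖y - (A x + A₁ z)‖ ^ 2 ≤ (γ * ‖x‖ + ω) ^ 2 :=
    pow_le_pow_left₀ (norm_nonneg _) hω 2
  have h3 : (γ * ‖x‖ + ω) ^ 2 ≤ γ ^ 2 * ‖x‖ ^ 2 + ε / 2 * ‖x‖ ^ 2 +
      (1 + 2 * γ ^ 2 / ε) * ω ^ 2 := by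
    have h4 : 0 ≤ ε / 2 * (‖x‖ - 2 * γ * ω / ε) ^ 2 := by positivity
    have h5 : ε / 2 * (‖x‖ - 2 * γ * ω / ε) ^ 2 =
        ε / 2 * ‖x‖ ^ 2 - 2 * γ * ‖x‖ * ω + 2 * γ ^ 2 / ε * ω ^ 2 := by
      field_simp
      ring
    linarith [h4, h5]
  have h6 : 0 ≤ Real.exp (k * h) - 1 := sub_nonneg.2 (Real.one_le_exp (by positivity))
  have h7 := mul_le_mul_of_nonneg_left (inner_apply_le P x) hk
  have h8 := mul_le_mul_of_nonneg_left (inner_apply_le S x) h6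
  have h9 := mul_le_mul_of_nonneg_left (inner_apply_le R y) (mul_nonneg h6 (sq_nonneg h))
  have h10 := mul_le_mul_of_nonneg_right hS (sq_nonneg ‖x‖)
  have h11 := mul_le_mul_of_nonneg_right hR (sq_nonneg ‖y‖)
  linarith

/-- The integrated dissipation inequality, for times at which the derivative is available on the
whole delay interval. -/
theorem IsPerturbedTrajectory.exp_mul_inner_le [CompleteSpace E]
    (he : IsPerturbedTrajectory A A₁ h γ ω m T e d) (hh : 0 ≤ h) (hγ : 0 ≤ γ)
    (hPsymm : ∀ x y, inner ℝ x (P y) = inner ℝ y (P x))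
    (hRsymm : ∀ x y, inner ℝ x (R y) = inner ℝ y (R x))
    (hRpos : ∀ x, 0 ≤ inner ℝ x (R x)) (hSpos : ∀ x, 0 ≤ inner ℝ x (S x))
    {ε k : ℝ} (hL : IsDissipative A A₁ P R S h γ ε) (hε : 0 < ε)
    (hk : 0 < k) (hkS : k * ‖P‖ + (Real.exp (k * h) - 1) * ‖S‖ ≤ ε / 2)
    (hkR : (Real.exp (k * h) - 1) * (h ^ 2 * ‖R‖) ≤ ε) {τ : ℝ} (hτ : τ ∈ Set.Icc h T) :
    Real.exp (k * τ) * inner ℝ (e τ) (P (e τ)) ≤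
      Real.exp (k * h) * (inner ℝ (e h) (P (e h)) +
        (∫ t in (0 : ℝ)..h, Real.exp (k * t) * inner ℝ (e t) (S (e t))) +
        h ^ 2 * ∫ t in (0 : ℝ)..h, Real.exp (k * t) * inner ℝ (d t) (R (d t))) +
      (1 + 2 * γ ^ 2 / ε) * ω ^ 2 * (Real.exp (k * τ) / k) := by
  have h0τ : 0 ≤ τ := hh.trans hτ.1
  obtain ⟨B, hB⟩ := isCompact_Icc.exists_bound_of_continuousOn
    (s := Set.Icc (-h) T) e.continuous.continuousOn
  have hD := he.norm_deriv_le hh hγ le_rfl hB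
  rw [← Set.uIoc_of_le he.nonneg] at hD
  have hftc := exp_mul_inner_sub_eq_integral hPsymm k hh hτ.1 hτ.2 he.integrable hD he.eq_integral
  set qS : ℝ → ℝ := fun t => inner ℝ (e t) (S (e t)) with hqS
  set qR : ℝ → ℝ := fun t => inner ℝ (d t) (R (d t)) with hqR
  have hsub : Set.uIcc 0 τ ⊆ Set.uIcc 0 T := by
    rw [Set.uIcc_of_le h0τ, Set.uIcc_of_le he.nonneg]
    exact Set.Icc_subset_Icc_right hτ.2
  have hsub' : Set.uIcc h τ ⊆ Set.uIcc 0 τ := by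
    rw [Set.uIcc_of_le h0τ, Set.uIcc_of_le hτ.1]
    exact Set.Icc_subset_Icc_left hh
  have hqRint : IntervalIntegrable qR volume 0 τ :=
    (intervalIntegrable_inner_apply R he.integrable hD).mono_set hsub
  have hqScont : Continuous qS := by
    have : Continuous fun t => S (e t) := S.continuous.comp e.continuous
    exact e.continuous.inner this
  have hgR : IntervalIntegrable (fun t => Real.exp (k * t) * qR t) volume 0 τ :=
    hqRint.continuousOn_mul (by fun_prop)
  have hgS : ∀ a b, IntervalIntegrable (fun t => Real.exp (k * t) * qS t) volume a b := fun a b =>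
    Continuous.intervalIntegrable (by fun_prop) _ _
  have hgSd : ∀ a b, IntervalIntegrable (fun t => Real.exp (k * t) * qS (t - h)) volume a b :=
    fun a b => Continuous.intervalIntegrable (by fun_prop) _ _
  have hJcont : ContinuousOn (fun t => ∫ s in (t - h)..t, qR s) (Set.uIcc h τ) := by
    rw [Set.uIcc_of_le hτ.1]
    exact continuousOn_integral_delay hh hτ.1 hqRint
  have hgJ : IntervalIntegrable (fun t => Real.exp (k * t) * ∫ s in (t - h)..t, qR s)
      volume h τ := (ContinuousOn.mul (by fun_prop) hJcont).intervalIntegrable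
  have hgexp : IntervalIntegrable (fun t => Real.exp (k * t)) volume h τ :=
    Continuous.intervalIntegrable (by fun_prop) _ _
  set C := (1 + 2 * γ ^ 2 / ε) * ω ^ 2 with hC
  have hC0 : 0 ≤ C := by positivity
  have hpt : ∀ᵐ t ∂(volume.restrict (Set.Icc h τ)), Real.exp (k * t) *
        (k * inner ℝ (e t) (P (e t)) + 2 * inner ℝ (d t) (P (e t))) ≤
      Real.exp (k * t) * qS (t - h) - Real.exp (k * h) * (Real.exp (k * t) * qS t) +
        (h * (Real.exp (k * t) * ∫ s in (t - h)..t, qR s) -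
          Real.exp (k * h) * h ^ 2 * (Real.exp (k * t) * qR t)) + C * Real.exp (k * t) := by
    rw [← Measure.restrict_congr_set Ioc_ae_eq_Icc]
    filter_upwards [ae_restrict_of_ae_restrict_of_subset (Set.Ioc_subset_Ioc hh hτ.2) he.bound,
      ae_restrict_mem measurableSet_Ioc] with t ht hmem
    have h1 := hL.weighted_le hε hh hk.le hkS hkR ht
    have hsubt : Set.uIcc (t - h) t ⊆ Set.uIcc 0 τ := by
      rw [Set.uIcc_of_le h0τ, Set.uIcc_of_le (by linarith)]
      exact Set.Icc_subset_Icc (by linarith [hmem.1]) hmem.2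
    have h2 : e t - e (t - h) = ∫ s in (t - h)..t, d s := by
      rw [he.eq_integral t ⟨hh.trans hmem.1.le, hmem.2.trans hτ.2⟩,
        he.eq_integral (t - h) ⟨by linarith [hmem.1], by linarith [hmem.2, hτ.2]⟩,
        add_sub_add_left_eq_sub]
      refine intervalIntegral.integral_interval_sub_left (he.integrable.mono_set ?_)
        (he.integrable.mono_set ?_)
      · rw [Set.uIcc_of_le he.nonneg, Set.uIcc_of_le (hh.trans hmem.1.le)]
        exact Set.Icc_subset_Icc_right (hmem.2.trans hτ.2)
      · rw [Set.uIcc_of_le he.nonneg, Set.uIcc_of_le (by linarith [hmem.1])]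
        exact Set.Icc_subset_Icc_right (by linarith [hmem.2, hτ.2])
    -- Jensen on [t-h, t] is available because t ≥ h keeps the interval inside [0, T].
    have h3 : inner ℝ (e t - e (t - h)) (R (e t - e (t - h))) ≤ h * ∫ s in (t - h)..t, qR s := by
      have := inner_integral_le hRsymm hRpos (by linarith : t - h ≤ t)
        (he.integrable.mono_set (hsubt.trans hsub)) (hqRint.mono_set hsubt)
      rw [sub_sub_cancel] at this
      rwa [h2]
    have h4 := mul_le_mul_of_nonneg_left (h1.trans (by gcongr : _ ≤
      qS (t - h) - Real.exp (k * h) * qS t + (h * (∫ s in (t - h)..t, qR s) -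
        Real.exp (k * h) * h ^ 2 * qR t) + C)) (Real.exp_pos (k * t)).le
    refine h4.trans (le_of_eq ?_)
    ring
  have hgR' := hgR.mono_set hsub'
  have hi1 := (hgSd h τ).sub ((hgS h τ).const_mul (Real.exp (k * h)))
  have hi2 := (hgJ.const_mul h).sub (hgR'.const_mul (Real.exp (k * h) * h ^ 2))
  have hmono := intervalIntegral.integral_mono_ae_restrict hτ.1 ?_
    ((hi1.add hi2).add (hgexp.const_mul C)) hpt
  · rw [← hftc, intervalIntegral.integral_add (hi1.add hi2) (hgexp.const_mul C),
      intervalIntegral.integral_add hi1 hi2,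
      intervalIntegral.integral_sub (hgSd h τ) ((hgS h τ).const_mul _),
      intervalIntegral.integral_sub (hgJ.const_mul h) (hgR'.const_mul _),
      intervalIntegral.integral_const_mul, intervalIntegral.integral_const_mul,
      intervalIntegral.integral_const_mul, intervalIntegral.integral_const_mul] at hmono
    -- The delayed integrals are bounded by exp(kh) times integrals over [0, τ]; the negative terms
    -- cancel the part over [h, τ] and leave only [0, h].
    have e1 := integral_exp_mul_delay_le (k := k) hh hτ.1
      (hqScont.intervalIntegrable 0 τ) fun s => hSpos _
    have e2 := integral_exp_mul_integral_delay_le (k := k) hh hτ.1 hk.le hqRint fun s => hRpos _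
    have e2' := mul_le_mul_of_nonneg_left e2 hh
    have e3 := intervalIntegral.integral_add_adjacent_intervals (hgS 0 h) (hgS h τ)
    have hsub0 : Set.uIcc 0 h ⊆ Set.uIcc 0 τ := by
      rw [Set.uIcc_of_le h0τ, Set.uIcc_of_le hh]
      exact Set.Icc_subset_Icc_right hτ.1
    have e4 := intervalIntegral.integral_add_adjacent_intervals (hgR.mono_set hsub0) hgR'
    have e5 : ∫ t in h..τ, Real.exp (k * t) ≤ Real.exp (k * τ) / k := by
      have hd : ∀ t ∈ Set.uIcc h τ,
          HasDerivAt (fun t => Real.exp (k * t) / k) (Real.exp (k * t)) t := by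
        intro t _
        have := (((hasDerivAt_id t).const_mul k).exp).div_const k
        simpa [hk.ne'] using this
      rw [intervalIntegral.integral_eq_sub_of_hasDerivAt hd hgexp]
      have : 0 < Real.exp (k * h) / k := div_pos (Real.exp_pos _) hk
      linarith
    have e6 := mul_le_mul_of_nonneg_left e5 hC0
    rw [← e3] at e1
    rw [← e4] at e2'
    linarith
  · refine IntervalIntegrable.continuousOn_mul ?_ (by fun_prop)
    refine IntervalIntegrable.add (Continuous.intervalIntegrable ?_ _ _)
      (IntervalIntegrable.const_mul ?_ 2)
    · have : Continuous fun t => P (e t) := P.continuous.comp e.continuous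
      exact (e.continuous.inner this).const_mul k
    · have hdτ := (he.integrable.mono_set hsub).mono_set hsub'
      have hm := hdτ.def'.aestronglyMeasurable
      have hPe : Continuous fun t => P (e t) := P.continuous.comp e.continuous
      refine (intervalIntegrable_const (c := ((‖A‖ + ‖A₁‖ + γ) * B + ω) * (‖P‖ * B))).mono_fun
        (hm.inner hPe.aestronglyMeasurable) ?_
      have hsubo : Set.uIoc h τ ⊆ Set.uIoc 0 T := by
        rw [Set.uIoc_of_le he.nonneg, Set.uIoc_of_le hτ.1]
        exact Set.Ioc_subset_Ioc hh hτ.2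
      filter_upwards [ae_restrict_of_ae_restrict_of_subset hsubo hD,
        ae_restrict_mem measurableSet_uIoc] with t ht hmem
      rw [Set.uIoc_of_le hτ.1] at hmem
      refine (norm_inner_le_norm _ _).trans (le_trans ?_ (Real.le_norm_self _))
      exact mul_le_mul ht (P.le_opNorm_of_le (hB t ⟨by linarith [hmem.1], hmem.2.trans hτ.2⟩))
        (norm_nonneg _) ((norm_nonneg _).trans ht)

end Estimate

/-! ### Exponential input-to-state estimate -/

section Estimate

variable {E : Type*} [NormedAddCommGroup E] [InnerProductSpace ℝ E]
variable {A A₁ P R S : E →L[ℝ] E} {h γ : ℝ}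

/-- Both left-hand sides are continuous in `k` and vanish at k = 0. -/
theorem exists_decay_rate {p s r h ε : ℝ} (hε : 0 < ε) :
    ∃ k : ℝ, 0 < k ∧ k * p + (Real.exp (k * h) - 1) * s ≤ ε / 2 ∧
      (Real.exp (k * h) - 1) * r ≤ ε := by
  have h1 : ∀ᶠ k in 𝓝 (0 : ℝ), k * p + (Real.exp (k * h) - 1) * s < ε / 2 :=
    (Continuous.tendsto (by fun_prop) 0).eventually_lt_const (by simpa using hε)
  have h2 : ∀ᶠ k in 𝓝 (0 : ℝ), (Real.exp (k * h) - 1) * r < ε :=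
    (Continuous.tendsto (by fun_prop) 0).eventually_lt_const (by simpa using hε)
  obtain ⟨k, ⟨hk1, hk2⟩, hk⟩ := (((h1.and h2).filter_mono nhdsWithin_le_nhds).and
    (self_mem_nhdsWithin (s := Set.Ioi (0 : ℝ)))).exists
  exact ⟨k, hk, hk1.le, hk2.le⟩

/-- Dividing by exp(kt) and taking the root halves the decay rate. The summand 1 in `C₄` gives C₄ ≤
C₄², so that no square root of the constant is needed. -/
theorem le_of_exp_mul_sq_le {k p C₂ C₃ C₄ a m ω t : ℝ} (hk : 0 < k) (ht : 0 ≤ t) (hp : 0 < p)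
    (hC₂ : 0 ≤ C₂) (hC₃ : 0 ≤ C₃) (hm : 0 ≤ m) (hω : 0 ≤ ω) (hC₄ : C₄ = (2 * C₂ + C₃) / p + 1)
    (h1 : Real.exp (k * t) * (p * a ^ 2) ≤
      C₂ * (m + ω) ^ 2 + C₃ * ω ^ 2 * Real.exp (k * t)) :
    a ≤ C₄ * (Real.exp (-(k / 2) * t) * m + ω) := by
  have hC₄one : 1 ≤ C₄ := hC₄ ▸ le_add_of_nonneg_left (by positivity)
  have hexp0 := Real.exp_pos (-(k / 2) * t)
  set E' := Real.exp (-(k / 2) * t) with hE'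
  have hEE : E' ^ 2 * Real.exp (k * t) = 1 := by
    rw [hE', ← Real.exp_nat_mul, ← Real.exp_add, Real.exp_eq_one_iff]
    push_cast
    ring
  have hE1 : E' ^ 2 ≤ 1 := by
    have : E' ≤ 1 := Real.exp_le_one_iff.2 (by nlinarith [ht])
    exact pow_le_one₀ hexp0.le this
  have h2 : p * a ^ 2 ≤ C₂ * (m + ω) ^ 2 * E' ^ 2 + C₃ * ω ^ 2 := by
    have h3 := mul_le_mul_of_nonneg_left h1 (sq_nonneg E')
    have h4 : E' ^ 2 * (Real.exp (k * t) * (p * a ^ 2)) = p * a ^ 2 := by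
      rw [← mul_assoc, hEE, one_mul]
    have h5 : E' ^ 2 * (C₂ * (m + ω) ^ 2 + C₃ * ω ^ 2 * Real.exp (k * t)) =
        C₂ * (m + ω) ^ 2 * E' ^ 2 + C₃ * ω ^ 2 * (E' ^ 2 * Real.exp (k * t)) := by ring
    rw [h4, h5, hEE, mul_one] at h3
    exact h3
  have h3 : p * a ^ 2 ≤ (2 * C₂ + C₃) * (E' ^ 2 * m ^ 2 + ω ^ 2) := by
    have h4 : (m + ω) ^ 2 ≤ 2 * m ^ 2 + 2 * ω ^ 2 := by nlinarith [sq_nonneg (m - ω)]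
    have h5 : C₂ * (m + ω) ^ 2 * E' ^ 2 ≤ C₂ * (2 * m ^ 2 + 2 * ω ^ 2) * E' ^ 2 := by gcongr
    have h6 : C₂ * (2 * ω ^ 2) * E' ^ 2 ≤ C₂ * (2 * ω ^ 2) * 1 := by gcongr
    have h7 : 0 ≤ C₃ * (E' ^ 2 * m ^ 2) := by positivity
    linarith
  have h4 : a ^ 2 ≤ (C₄ * (E' * m + ω)) ^ 2 := by
    calc a ^ 2 ≤ (2 * C₂ + C₃) / p * (E' ^ 2 * m ^ 2 + ω ^ 2) := by
          rw [div_mul_eq_mul_div, le_div_iff₀ hp]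
          linarith
      _ ≤ C₄ * (E' ^ 2 * m ^ 2 + ω ^ 2) := by
          refine mul_le_mul_of_nonneg_right ?_ (by positivity)
          rw [hC₄]
          linarith
      _ ≤ C₄ ^ 2 * (E' * m + ω) ^ 2 := by
          refine mul_le_mul (le_self_pow₀ hC₄one two_ne_zero) ?_ (by positivity) (by positivity)
          have : 0 ≤ E' * m * ω := by positivity
          linarith
      _ = _ := by ring
  exact le_of_sq_le_sq h4 (by positivity)

/-- A dissipative delay system satisfies an exponential input-to-state estimate. -/
theorem IsDissipative.exists_exponential_estimate [CompleteSpace E] (hh : 0 ≤ h) (hγ : 0 ≤ γ)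
    (hPsymm : ∀ x y, inner ℝ x (P y) = inner ℝ y (P x))
    (hRsymm : ∀ x y, inner ℝ x (R y) = inner ℝ y (R x))
    {p : ℝ} (hp : 0 < p) (hPpos : ∀ x, p * ‖x‖ ^ 2 ≤ inner ℝ x (P x))
    (hRpos : ∀ x, 0 ≤ inner ℝ x (R x)) (hSpos : ∀ x, 0 ≤ inner ℝ x (S x))
    {ε : ℝ} (hL : IsDissipative A A₁ P R S h γ ε) (hε : 0 < ε) :
    ∃ L lam : ℝ, 0 < L ∧ 0 < lam ∧ ∀ (m ω T : ℝ) (e : C(ℝ, E)) (d : ℝ → E), 0 ≤ ω →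
      IsPerturbedTrajectory A A₁ h γ ω m T e d →
        ∀ t ∈ Set.Icc 0 T, ‖e t‖ ≤ L * Real.exp (-lam * t) * m + L * ω := by
  obtain ⟨k, hk, hkS, hkR⟩ :=
    exists_decay_rate (p := ‖P‖) (s := ‖S‖) (r := h ^ 2 * ‖R‖) (h := h) hε
  -- Relative to m + ω, `C₀` bounds the state on [-h, h] and `C₁` the derivative on [0, h]; `C₂`
  -- collects the terms left at time h and `C₃` is the input's contribution.
  set C₀ := (1 + h * (‖A₁‖ + 1)) * Real.exp ((‖A‖ + γ + 1) * h) with hC₀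
  set C₁ := (‖A‖ + ‖A₁‖ + γ) * C₀ + 1 with hC₁
  set C₂ := Real.exp (k * h) * (‖P‖ * C₀ ^ 2 + Real.exp (k * h) * (‖S‖ * C₀ ^ 2) * h +
    h ^ 2 * (Real.exp (k * h) * (‖R‖ * C₁ ^ 2) * h)) with hC₂
  set C₃ := (1 + 2 * γ ^ 2 / ε) / k with hC₃
  set C₄ := (2 * C₂ + C₃) / p + 1 with hC₄
  have hC₀pos : 0 < C₀ := by positivity
  have hC₁pos : 0 < C₁ := by positivity
  have hC₂nn : 0 ≤ C₂ := by positivity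
  have hC₃nn : 0 ≤ C₃ := by positivity
  have hC₄one : 1 ≤ C₄ := le_add_of_nonneg_left (by positivity)
  clear_value C₀ C₁ C₂ C₃ C₄
  -- `C₄` serves t ≥ h. For t ≤ h the factor exp(kh/2) compensates the decay exp(-kt/2), so the
  -- Gronwall bound suffices.
  refine ⟨C₄ + C₀ * Real.exp (k / 2 * h), k / 2, by positivity, by positivity, ?_⟩
  intro m ω T e d hω he t ht
  have hm : 0 ≤ m := (norm_nonneg _).trans (he.initial 0 ⟨by linarith, le_rfl⟩)
  have hexp0 := Real.exp_pos (-(k / 2) * t)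
  have hexph : 1 ≤ Real.exp (k / 2 * h) := Real.one_le_exp (by positivity)
  rcases le_total t h with hth | hth
  · have h1 := he.norm_le_initial hh hγ hω ht.2 ⟨by linarith [ht.1], hth⟩
    rw [← hC₀] at h1
    have h2 : 1 ≤ Real.exp (k / 2 * h) * Real.exp (-(k / 2) * t) := by
      rw [← Real.exp_add]
      exact Real.one_le_exp (by nlinarith)
    have h3 := mul_le_mul_of_nonneg_left h2 (mul_nonneg hC₀pos.le hm)
    have h4 := mul_le_mul_of_nonneg_left hexph (mul_nonneg hC₀pos.le hω)
    have h5 : 0 ≤ C₄ * (Real.exp (-(k / 2) * t) * m) := by positivity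
    have h6 : 0 ≤ C₄ * ω := by positivity
    linarith
  · have hhT := hth.trans ht.2
    have hinit : ∀ s ∈ Set.Icc (-h) h, ‖e s‖ ≤ C₀ * (m + ω) := fun s hs =>
      hC₀ ▸ he.norm_le_initial hh hγ hω (hs.2.trans hhT) hs
    have hderiv : ∀ᵐ s ∂(volume.restrict (Set.Ioc 0 h)), ‖d s‖ ≤ C₁ * (m + ω) := by
      filter_upwards [he.norm_deriv_le hh hγ hhT hinit] with s hs
      rw [hC₁]
      linarith
    have hquad : ∀ (Q : E →L[ℝ] E) {x : E} {b : ℝ}, ‖x‖ ≤ b * (m + ω) →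
        inner ℝ x (Q x) ≤ ‖Q‖ * b ^ 2 * (m + ω) ^ 2 := by
      intro Q x b hx
      have h1 := mul_le_mul_of_nonneg_left (pow_le_pow_left₀ (norm_nonneg _) hx 2) (norm_nonneg Q)
      rw [mul_pow, ← mul_assoc] at h1
      exact (inner_apply_le Q x).trans h1
    have hexpm : ∀ s ∈ Set.Ioc 0 h, Real.exp (k * s) ≤ Real.exp (k * h) := fun s hs =>
      Real.exp_le_exp.2 (mul_le_mul_of_nonneg_left hs.2 hk.le)
    have hSint : ∫ s in (0 : ℝ)..h, Real.exp (k * s) * inner ℝ (e s) (S (e s)) ≤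
        Real.exp (k * h) * (‖S‖ * C₀ ^ 2 * (m + ω) ^ 2) * h := by
      have := intervalIntegral.norm_integral_le_of_norm_le_const (a := 0) (b := h)
        (f := fun s => Real.exp (k * s) * inner ℝ (e s) (S (e s)))
        (C := Real.exp (k * h) * (‖S‖ * C₀ ^ 2 * (m + ω) ^ 2)) ?_
      · rw [sub_zero, abs_of_nonneg hh] at this
        exact (Real.le_norm_self _).trans this
      · intro s hs
        rw [Set.uIoc_of_le hh] at hs
        rw [Real.norm_of_nonneg (mul_nonneg (Real.exp_pos _).le (hSpos _))]
        exact mul_le_mul (hexpm s hs) (hquad S (hinit s ⟨by linarith [hs.1], hs.2⟩)) (hSpos _)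
          (Real.exp_pos _).le
    have hRint : ∫ s in (0 : ℝ)..h, Real.exp (k * s) * inner ℝ (d s) (R (d s)) ≤
        Real.exp (k * h) * (‖R‖ * C₁ ^ 2 * (m + ω) ^ 2) * h := by
      have := intervalIntegral.norm_integral_le_of_norm_le_const_ae (a := 0) (b := h)
        (f := fun s => Real.exp (k * s) * inner ℝ (d s) (R (d s)))
        (C := Real.exp (k * h) * (‖R‖ * C₁ ^ 2 * (m + ω) ^ 2)) ?_
      · rw [sub_zero, abs_of_nonneg hh] at this
        exact (Real.le_norm_self _).trans this
      · rw [Set.uIoc_of_le hh]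
        filter_upwards [(ae_restrict_iff' measurableSet_Ioc).1 hderiv] with s hs' hs
        rw [Real.norm_of_nonneg (mul_nonneg (Real.exp_pos _).le (hRpos _))]
        exact mul_le_mul (hexpm s hs) (hquad R (hs' hs)) (hRpos _) (Real.exp_pos _).le
    have hmain := he.exp_mul_inner_le hh hγ hPsymm hRsymm hRpos hSpos hL hε hk hkS hkR
      (τ := t) ⟨hth, ht.2⟩
    have hPh := hquad P (hinit h ⟨by linarith, le_rfl⟩)
    have h1 : Real.exp (k * t) * (p * ‖e t‖ ^ 2) ≤
        C₂ * (m + ω) ^ 2 + C₃ * ω ^ 2 * Real.exp (k * t) := by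
      calc Real.exp (k * t) * (p * ‖e t‖ ^ 2)
          ≤ Real.exp (k * t) * inner ℝ (e t) (P (e t)) :=
            mul_le_mul_of_nonneg_left (hPpos _) (Real.exp_pos _).le
        _ ≤ Real.exp (k * h) * (‖P‖ * C₀ ^ 2 * (m + ω) ^ 2 +
            Real.exp (k * h) * (‖S‖ * C₀ ^ 2 * (m + ω) ^ 2) * h +
            h ^ 2 * (Real.exp (k * h) * (‖R‖ * C₁ ^ 2 * (m + ω) ^ 2) * h)) +
            (1 + 2 * γ ^ 2 / ε) * ω ^ 2 * (Real.exp (k * t) / k) := by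
          refine hmain.trans ?_
          gcongr
        _ = _ := by
          rw [hC₂, hC₃]
          ring
    have h5 := le_of_exp_mul_sq_le hk ht.1 hp hC₂nn hC₃nn hm hω hC₄ h1
    have h6 : 0 ≤ C₀ * Real.exp (k / 2 * h) * (Real.exp (-(k / 2) * t) * m) := by positivity
    have h7 : 0 ≤ C₀ * Real.exp (k / 2 * h) * ω := by positivity
    linarith

end Estimate

/-! ### From the matrix inequality to dissipation -/

section Matrices

open scoped Matrix

theorem inner_toEuclideanLin_transpose {ι : Type*} [Fintype ι] [DecidableEq ι]
    (M : Matrix ι ι ℝ) (x y : EuclideanSpace ℝ ι) :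
    inner ℝ x (Mᵀ.toEuclideanLin y) = inner ℝ y (M.toEuclideanLin x) := by
  rw [← Matrix.conjTranspose_eq_transpose_of_trivial, Matrix.toEuclideanLin_conjTranspose_eq_adjoint,
    LinearMap.adjoint_inner_right, real_inner_comm]

theorem inner_toEuclideanLin_comm {ι : Type*} [Fintype ι] [DecidableEq ι]
    {M : Matrix ι ι ℝ} (hM : M.IsHermitian) (x y : EuclideanSpace ℝ ι) :
    inner ℝ x (M.toEuclideanLin y) = inner ℝ y (M.toEuclideanLin x) := by
  rw [← inner_toEuclideanLin_transpose, ← Matrix.conjTranspose_eq_transpose_of_trivial, hM.eq]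

theorem inner_toEuclideanLin_pos {ι : Type*} [Fintype ι] [DecidableEq ι]
    {M : Matrix ι ι ℝ} (hM : M.PosDef) {x : EuclideanSpace ℝ ι} (hx : x ≠ 0) :
    0 < inner ℝ x (M.toEuclideanLin x) := by
  have h1 := hM.dotProduct_mulVec_pos (x := x.ofLp) (by simpa using hx)
  rw [EuclideanSpace.inner_eq_star_dotProduct, Matrix.ofLp_toLpLin, Matrix.toLin'_apply,
    dotProduct_comm]
  exact h1

/-- A positive definite matrix is coercive. -/
theorem exists_mul_norm_sq_le_inner {ι : Type*} [Fintype ι] [DecidableEq ι]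
    {M : Matrix ι ι ℝ} (hM : M.PosDef) :
    ∃ p : ℝ, 0 < p ∧ ∀ x : EuclideanSpace ℝ ι, p * ‖x‖ ^ 2 ≤ inner ℝ x (M.toEuclideanLin x) := by
  have hcont : Continuous fun x : EuclideanSpace ℝ ι => inner ℝ x (M.toEuclideanLin x) :=
    continuous_id.inner M.toEuclideanLin.continuous_of_finiteDimensional
  have hscale : ∀ x : EuclideanSpace ℝ ι, x ≠ 0 → ‖x‖⁻¹ • x ∈ Metric.sphere 0 1 := by
    intro x hx
    simp [norm_smul, hx]
  -- The unit sphere is empty in dimension zero; otherwise the minimum of the form on it is the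
  -- coercivity constant.
  rcases (Metric.sphere (0 : EuclideanSpace ℝ ι) 1).eq_empty_or_nonempty with hempty | hne
  · refine ⟨1, one_pos, fun x => ?_⟩
    have hx : x = 0 := by
      by_contra hx
      simpa [hempty] using hscale x hx
    simp [hx]
  · obtain ⟨x₀, hx₀, hmin⟩ :=
      (isCompact_sphere (0 : EuclideanSpace ℝ ι) 1).exists_isMinOn hne hcont.continuousOn
    refine ⟨_, inner_toEuclideanLin_pos hM (ne_zero_of_mem_unit_sphere ⟨x₀, hx₀⟩), fun x => ?_⟩
    by_cases hx : x = 0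
    · simp [hx]
    have h1 : inner ℝ x₀ (M.toEuclideanLin x₀) ≤
        inner ℝ (‖x‖⁻¹ • x) (M.toEuclideanLin (‖x‖⁻¹ • x)) := hmin (hscale x hx)
    rw [map_smul, inner_smul_left, inner_smul_right] at h1
    have h2 : 0 < ‖x‖ := norm_pos_iff.2 hx
    have h3 := mul_le_mul_of_nonneg_right h1 (sq_nonneg ‖x‖)
    refine h3.trans (le_of_eq ?_)
    simp only [conj_trivial]
    field_simp

/-- The quadratic form of a flattened block matrix is the sum of those of its blocks. -/
theorem inner_comp_toEuclideanLin {ι κ : Type*} [Fintype ι] [DecidableEq ι] [Fintype κ]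
    [DecidableEq κ] (W : Matrix ι ι (Matrix κ κ ℝ)) (u : ι → EuclideanSpace ℝ κ) :
    inner ℝ (WithLp.toLp 2 fun p : ι × κ => u p.1 p.2)
        ((Matrix.comp ι ι κ κ ℝ W).toEuclideanLin (WithLp.toLp 2 fun p : ι × κ => u p.1 p.2)) =
      ∑ i, ∑ j, inner ℝ (u i) ((W i j).toEuclideanLin (u j)) := by
  simp only [EuclideanSpace.inner_eq_star_dotProduct, Matrix.ofLp_toLpLin, Matrix.toLin'_apply,
    dotProduct, Matrix.mulVec, star_trivial, Fintype.sum_prod_type, Matrix.comp_apply,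
    Finset.sum_mul]
  refine Finset.sum_congr rfl fun i _ => ?_
  rw [Finset.sum_comm]

theorem norm_sq_toLp_prod {ι κ : Type*} [Fintype ι] [Fintype κ]
    (u : ι → EuclideanSpace ℝ κ) :
    ‖(WithLp.toLp 2 fun p : ι × κ => u p.1 p.2 : EuclideanSpace ℝ (ι × κ))‖ ^ 2 =
      ∑ i, ‖u i‖ ^ 2 := by
  simp only [EuclideanSpace.norm_sq_eq, Fintype.sum_prod_type]

variable {n : ℕ}

/-- The matrix inequality gives the dissipation inequality, by the descriptor method. -/
theorem exists_isDissipative {h γ : ℝ} {A A₁ P R S P₂ P₃ P₄ : Matrix (Fin n) (Fin n) ℝ}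
    (hP : P.IsHermitian) (hR : R.IsHermitian)
    (hW : (-lmiMatrix h γ A A₁ P R S P₂ P₃ P₄).PosDef) :
    ∃ ε : ℝ, 0 < ε ∧ IsDissipative A.toEuclideanLin.toContinuousLinearMap
      A₁.toEuclideanLin.toContinuousLinearMap P.toEuclideanLin.toContinuousLinearMap
      R.toEuclideanLin.toContinuousLinearMap S.toEuclideanLin.toContinuousLinearMap h γ ε := by
  obtain ⟨ε, hε, hcoercive⟩ := exists_mul_norm_sq_le_inner hW
  refine ⟨ε, hε, fun x y z v hy => ?_⟩
  have key := hcoercive (WithLp.toLp 2 fun p => ![x, y, z, v] p.1 p.2)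
  rw [norm_sq_toLp_prod, map_neg, LinearMap.neg_apply, inner_neg_right, lmiMatrix,
    inner_comp_toEuclideanLin] at key
  simp only [Fin.sum_univ_four, Matrix.of_apply, Matrix.cons_val', Matrix.cons_val_zero,
    Matrix.cons_val_one, Matrix.cons_val, inner_toEuclideanLin_transpose, map_add, map_sub, map_neg,
    map_smul, LinearMap.add_apply, LinearMap.sub_apply, LinearMap.neg_apply, LinearMap.smul_apply,
    inner_add_right, inner_sub_right, inner_neg_right, inner_smul_right, Matrix.toLpLin_one,
    LinearMap.id_apply, real_inner_self_eq_norm_sq, Matrix.toLpLin_mul_same,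
    LinearMap.comp_apply] at key
  have hPxy := inner_toEuclideanLin_comm hP x y
  have hRxz := inner_toEuclideanLin_comm hR x z
  simp only [LinearMap.coe_toContinuousLinearMap'] at hy ⊢
  set a := A.toEuclideanLin x
  set b := A₁.toEuclideanLin z
  -- The equation for y is tested against P₂x, P₃y and P₄v; these identities cancel every term
  -- containing P₂, P₃ or P₄.
  have e : ∀ g, inner ℝ y g = inner ℝ a g + inner ℝ b g + inner ℝ v g := by
    intro g
    rw [hy, inner_add_left, inner_add_left]
  have e₂ := e (P₂.toEuclideanLin x)
  have e₃ := e (P₃.toEuclideanLin y)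
  have e₄ := e (P₄.toEuclideanLin v)
  have c₂ := real_inner_comm a (P₂.toEuclideanLin x)
  have c₃ := real_inner_comm a (P₃.toEuclideanLin y)
  have c₄ := real_inner_comm a (P₄.toEuclideanLin v)
  have c₅ := real_inner_comm b (P₄.toEuclideanLin v)
  -- Coercivity also controls ‖z‖² and ‖v‖²; these parts of the margin are dropped.
  have hnn : 0 ≤ ε * (‖z‖ ^ 2 + ‖v‖ ^ 2) := by positivity
  rw [map_sub, inner_sub_left, inner_sub_right, inner_sub_right]
  linarith

end Matrices

/-! ### Comparison functions and the gain margin -/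

section GainMargin

theorem classKInf_const_mul {γ : ℝ≥0} (hγ : 0 < γ) : ClassKInf fun θ => γ * θ where
  classK :=
    { continuous := by fun_prop
      strictMono := fun _ _ hab => mul_lt_mul_of_pos_left hab hγ
      map_zero := mul_zero _ }
  tendsto := tendsto_id.const_mul_atTop hγ

theorem classKL_mul_exp {L : ℝ≥0} (hL : 0 < L) {lam : ℝ} (hlam : 0 < lam) :
    ClassKL fun θ t => L * (Real.exp (-lam * t)).toNNReal * θ where
  classK t := (classKInf_const_mul (mul_pos hL (Real.toNNReal_pos.2 (Real.exp_pos _)))).classK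
  continuous θ := by fun_prop
  antitone θ s t hst := by
    have hst' : (s : ℝ) ≤ t := hst
    have h1 : Real.exp (-lam * t) ≤ Real.exp (-lam * s) := Real.exp_le_exp.2 (by nlinarith)
    have h2 := Real.toNNReal_le_toNNReal h1
    exact mul_le_mul' (mul_le_mul' le_rfl h2) le_rfl
  tendsto θ := by
    have h1 : Tendsto (fun t : ℝ≥0 => lam * (t : ℝ)) atTop atTop :=
      (NNReal.tendsto_coe_atTop.2 tendsto_id).const_mul_atTop hlam
    have h2 : Tendsto (fun t : ℝ≥0 => (Real.exp (-lam * t)).toNNReal) atTop (𝓝 0) := by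
      have := tendsto_real_toNNReal (Real.tendsto_exp_neg_atTop_nhds_zero.comp h1)
      simpa [Function.comp_def] using this
    simpa using (h2.const_mul L).mul_const θ

variable {n : ℕ} {h : ℝ≥0}

/-- The derivative is taken to be the right-hand side along the solution, whose integrability is
part of being a solution; feedback and input then enter only through the bound γ‖e‖ + ω. -/
theorem IsSolutionOn.isPerturbedTrajectory {A A₁ : Matrix (Fin n) (Fin n) ℝ} {γ : ℝ≥0}
    {κ : EuclideanSpace ℝ (Fin n) → ℝ → EuclideanSpace ℝ (Fin n)}
    (hκ : ∀ ξ t, ‖κ ξ t‖₊ ≤ γ * ‖ξ‖₊) {e₀ : Hist h (EuclideanSpace ℝ (Fin n))}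
    {w : ℝ → EuclideanSpace ℝ (Fin n)} (hw : IsInput w) {T : ℝ} (hT : 0 ≤ T)
    {e : C(ℝ, EuclideanSpace ℝ (Fin n))}
    (he : IsSolutionOn (closedLoop (linearDelay h A A₁) κ) e₀ w T e) :
    IsPerturbedTrajectory A.toEuclideanLin.toContinuousLinearMap
      A₁.toEuclideanLin.toContinuousLinearMap h γ (inputNorm w) ‖e₀‖ T e
      (fun s => closedLoop (linearDelay h A A₁) κ s (segment h e s) (w s)) where
  nonneg := hT
  integrable := he.integrable
  eq_integral := he.eq_integral
  bound := by
    filter_upwards [ae_restrict_of_ae_restrict_of_subset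
      (fun s hs => hs.1.le : Set.Ioc 0 T ⊆ Set.Ici 0) (norm_le_inputNorm hw)] with s hs
    have hnow : (segment h e s).now = e s := congrArg e (add_zero s)
    have hdelayed : (segment h e s).delayed = e (s - h) := congrArg e (sub_eq_add_neg s h).symm
    have hk : ‖κ (e s) s‖ ≤ γ * ‖e s‖ := by exact_mod_cast hκ (e s) s
    simp only [closedLoop, linearDelay, hnow, hdelayed, LinearMap.coe_toContinuousLinearMap',
      add_sub_cancel_left]
    exact (norm_add_le _ _).trans (add_le_add hk hs)
  initial t ht := by
    have h1 : e t = e₀ ⟨t, ht⟩ := by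
      rw [← he.initial]
      exact congrArg e (zero_add t).symm
    rw [h1]
    exact e₀.norm_coe_le_norm _

theorem closedLoop_issEstimate {γ : ℝ≥0} {A A₁ P R S P₂ P₃ P₄ : Matrix (Fin n) (Fin n) ℝ}
    (hP : P.PosDef) (hR : R.PosDef) (hS : S.PosDef)
    (hW : (-lmiMatrix h γ A A₁ P R S P₂ P₃ P₄).PosDef)
    {κ : EuclideanSpace ℝ (Fin n) → ℝ → EuclideanSpace ℝ (Fin n)}
    (hκ : ∀ ξ t, ‖κ ξ t‖₊ ≤ γ * ‖ξ‖₊) :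
    ISSEstimate (closedLoop (linearDelay h A A₁) κ) := by
  obtain ⟨ε, hε, hdiss⟩ := exists_isDissipative hP.1 hR.1 hW
  obtain ⟨p, hp, hPpos⟩ := exists_mul_norm_sq_le_inner hP
  have hnonneg : ∀ {M : Matrix (Fin n) (Fin n) ℝ}, M.PosDef → ∀ x : EuclideanSpace ℝ (Fin n),
      0 ≤ inner ℝ x (M.toEuclideanLin.toContinuousLinearMap x) := by
    intro M hM x
    obtain ⟨q, hq, hM'⟩ := exists_mul_norm_sq_le_inner hM
    exact (by positivity : 0 ≤ q * ‖x‖ ^ 2).trans (hM' x)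
  obtain ⟨L, lam, hL, hlam, hest⟩ := hdiss.exists_exponential_estimate h.coe_nonneg γ.coe_nonneg
    (inner_toEuclideanLin_comm hP.1) (inner_toEuclideanLin_comm hR.1) hp hPpos (hnonneg hR)
    (hnonneg hS) hε
  lift L to ℝ≥0 using hL.le
  have hL' : 0 < L := hL
  refine ⟨_, _, classKL_mul_exp hL' hlam, (classKInf_const_mul hL').classK, ?_⟩
  intro e₀ w hw T e he t ht
  have h1 := hest _ _ _ e _ (inputNorm w).coe_nonneg
    (he.isPerturbedTrajectory hκ hw T.coe_nonneg) t ⟨t.coe_nonneg, ht⟩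
  rw [← NNReal.coe_le_coe]
  push_cast
  rwa [Real.coe_toNNReal _ (Real.exp_pos _).le]

end GainMargin

end DelayISS

theorem mainTheorem2 (n : ℕ) (h γ : ℝ≥0) (hγ : 0 < γ)
    (A A₁ P R S P₂ P₃ P₄ : Matrix (Fin n) (Fin n) ℝ)
    (hP : P.PosDef) (hR : R.PosDef) (hS : S.PosDef)
    (hW : (-DelayISS.lmiMatrix h γ A A₁ P R S P₂ P₃ P₄).PosDef) :
    DelayISS.HasGainMargin (DelayISS.linearDelay h A A₁) (fun θ => γ * θ) := by
  have hrobust : ∀ κ : EuclideanSpace ℝ (Fin n) → ℝ → EuclideanSpace ℝ (Fin n),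
      DelayISS.Caratheodory κ → (∀ ξ t, ‖κ ξ t‖₊ ≤ γ * ‖ξ‖₊) →
        DelayISS.IsISS (DelayISS.closedLoop (DelayISS.linearDelay h A A₁) κ) := fun κ hκ hb =>
    ⟨DelayISS.closedLoop_forwardComplete A A₁ hκ hb,
      DelayISS.closedLoop_issEstimate hP hR hS hW hb⟩
  refine ⟨DelayISS.classKInf_const_mul hγ, ?_,
    fun κ hb => DelayISS.closedLoop_issEstimate hP hR hS hW hb, hrobust⟩
  -- The nominal system is the closed loop with zero feedback.
  have h0 := hrobust (fun _ _ => 0)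
    ⟨fun _ => continuous_const, fun _ => aestronglyMeasurable_const⟩ (by simp)
  have hzero : DelayISS.closedLoop (DelayISS.linearDelay h A A₁) (fun _ _ => 0) =
      fun _ => DelayISS.linearDelay h A A₁ := by
    funext t φ v
    simp [DelayISS.closedLoop]
  rwa [hzero] at h0
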